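/- Let $\mu$ be a finite positive Borel measure on $\mathbb{R}^3$. For $t>0$ let $\mu_t(E)=\mu(t^{-1}E)$, and for a measurable $g:\mathbb{R}^3\to\mathbb{C}$ let $$M_\mu g(x)=\sup_{t>0}\,(|g|*\mu_t)(x)=\sup_{t>0}\int_{\mathbb{R}^3}|g(x-y)|\,\mathrm{d}\mu_t(y)\in[0,\infty].$$ Suppose that $M_\mu$ is bounded from $L^2(\mathbb{R}^3)$ to $L^2(\mathbb{R}^3)$, i.e. there is $A<\infty$ with $\|M_\mu g\|_{L^2(\mathbb{R}^3)}\le A\|g\|_{L^2(\mathbb{R}^3)}$ for all $g\in L^2(\mathbb{R}^3)$. Then for every $1\le p\le \tfrac43$ there is a constant $C_{p,\mu}<\infty$, depending only on $p$ and $\mu$, such that $$\|M_\mu(\widehat f)\|_{L^2(\mathbb{S}^2)}\le C_{p,\mu}\,\|f\|_{L^p(\mathbb{R}^3)}$$ for all $f\in L^1(\mathbb{R}^3)\cap L^p(\mathbb{R}^3)$ (in particular for all Schwartz functions $f$), where $\widehat f(\xi)=\int_{\mathbb{R}^3}e^{-2\pi i x\cdot\xi}f(x)\,\mathrm{d}x$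 and $L^2(\mathbb{S}^2)$ is taken with respect to surface measure on the unit sphere $\mathbb{S}^2$. -/

import Mathlib

open MeasureTheory FourierTransform
open scoped NNReal ENNReal

/-- The dilate `μ_t` of a measure on `ℝ³`, that is `μ_t(E) = μ(t⁻¹ E)`. -/
noncomputable def dilate (μ : Measure (EuclideanSpace ℝ (Fin 3))) (t : ℝ) :
    Measure (EuclideanSpace ℝ (Fin 3)) :=
  μ.map (fun y => t • y)

/-- The maximal function `M_μ g(x) = sup_{t > 0} (|g| * μ_t)(x)`, with values in `[0, ∞]`, where
`(|g| * μ_t)(x) = ∫ |g(x - y)| dμ_t(y)`. -/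
noncomputable def maximalFn (μ : Measure (EuclideanSpace ℝ (Fin 3)))
    (g : EuclideanSpace ℝ (Fin 3) → ℂ) (x : EuclideanSpace ℝ (Fin 3)) : ℝ≥0∞ :=
  ⨆ (t : ℝ) (_ : 0 < t), ∫⁻ y, ‖g (x - y)‖ₑ ∂(dilate μ t)

/-- `M_μ` is bounded from `L²(ℝ³)` to `L²(ℝ³)`. -/
def MaximalBoundedL2 (μ : Measure (EuclideanSpace ℝ (Fin 3))) : Prop :=
  ∃ A : ℝ≥0, ∀ g : EuclideanSpace ℝ (Fin 3) → ℂ, MemLp g 2 volume →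
    eLpNorm (maximalFn μ g) 2 volume ≤ A * eLpNorm g 2 volume

/-- Surface measure on the unit sphere `S²` of `ℝ³` (total mass `4π`). -/
noncomputable def sphereMeasure : Measure (Metric.sphere (0 : EuclideanSpace ℝ (Fin 3)) 1) :=
  (volume : Measure (EuclideanSpace ℝ (Fin 3))).toSphere

-- Linearise and dualise. Choose a measurable radius `τ(ω) > 0` at each point of the sphere, let
-- `g(ω)` be the average of `|𝓕 f|` selected by `τ`, and let `κ` be the superposition with weight
-- `g` of the images of `μ` under `y ↦ ω - τ(ω) y`. Then `∫ |𝓕 f| dκ = ‖g‖₂²`, and the left side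
-- equals `∫ f · (s κ)^` for the unimodular phase `s` that turns `𝓕 f` into its modulus. By Hölder
-- it is enough to bound `(s κ)^` by a multiple of `‖g‖₂` in `L^q` for all `q ≥ 4`. The case `q = ∞`
-- is the total mass of `κ`; the case `q = 4` is the heart of the matter.
--
-- Since 4 is even, the `L⁴` norm of `(s κ)^` is governed by the `L²` size of a self-convolution, in
-- which `s` can be dropped because everything left is positive. So `κ * κ` is tested against `W ≥
-- 0`. Integrating out the two displacements `τ(ω) y` costs two applications of the maximal
-- operator, whatever `τ` is, and replaces `κ` by `g dσ` (`exists_spreadMeasure_bilinear_sq_le`).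
-- What remains is the endpoint Stein–Tomas inequality `‖gσ * gσ‖₂ ≲ ‖g‖₂²`
-- (`exists_lintegral_sphere_bilinear_sq_le`).
--
-- That inequality is a count of quadruples with `|a + b + c + d| ≤ r`. The density of `σ * σ` is of
-- size `1/|x|`, singular only at the origin. Unit vectors with almost zero sum cannot have all
-- pairwise sums small (`eight_le_sum_norm_add_sq`), so by symmetry a weight `|a + b|²`, which
-- cancels the singularity, may be inserted at no cost (`eight_mul_lintegral_quadWeight_le`).
--
-- The passage from positive tests to Fourier transforms is a Gaussian-regularised Plancherel
-- argument (`ofReal_mul_gaussEnergy_le`), and a running argmax over a dense sequence of radii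
-- recovers the supremum.

local notation "𝔼" => EuclideanSpace ℝ (Fin 3)
local notation "𝕊" => Metric.sphere (0 : EuclideanSpace ℝ (Fin 3)) 1

/-! ### Surface measure of caps and bands -/

open Set Metric Pointwise in
/-- Thickening a subset of the sphere by `r` in the radial direction gives a set of volume at least
`r` times its surface measure. -/
theorem ofReal_mul_sphereMeasure_le {A : Set 𝕊}
    (hA : MeasurableSet A) {r : ℝ} (hr : 0 ≤ r) :
    ENNReal.ofReal r * sphereMeasure A ≤
      volume {y : 𝔼 | 1 ≤ ‖y‖ ∧ ‖y‖ ≤ 1 + r ∧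
        ∃ ω ∈ A, y = ‖y‖ • (ω : 𝔼)} := by
  set U : Set 𝔼 := Ioo (0 : ℝ) 1 • ((↑) '' A) with hU
  have hs : sphereMeasure A = 3 * volume U := by
    rw [sphereMeasure, Measure.toSphere_apply' _ hA]; simp [U]
  have hUfin : volume U ≠ ⊤ := by
    refine ne_top_of_le_ne_top (measure_ball_lt_top (x := (0 : 𝔼))
      (r := 1)).ne (measure_mono ?_)
    rintro _ ⟨s, hs, _, ⟨ω, -, rfl⟩, rfl⟩
    simp [norm_smul, abs_of_pos hs.1, hs.2]
  have hV : volume (Ioo (0 : ℝ) (1 + r) • ((↑) '' A : Set 𝔼)) =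
      ENNReal.ofReal ((1 + r) ^ 3) * volume U := by
    have : Ioo (0 : ℝ) (1 + r) = (1 + r) • Ioo (0 : ℝ) 1 := by
      rw [LinearOrderedField.smul_Ioo (by positivity)]; simp
    rw [this, smul_assoc, Measure.addHaar_smul_of_nonneg _ (by positivity)]
    simp [U]
  -- The thickening contains the difference of the cones over `A` of heights `1 + r` and `1`, and
  -- `(1 + r)³ - 1 ≥ 3r` absorbs the 3 relating surface measure to cone volume.
  calc ENNReal.ofReal r * sphereMeasure A
      = ENNReal.ofReal (3 * r) * volume U := by
        rw [hs, ENNReal.ofReal_mul (by norm_num)]; simp; ring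
    _ ≤ ENNReal.ofReal ((1 + r) ^ 3 - 1) * volume U := by
        gcongr; nlinarith [pow_nonneg hr 3, pow_nonneg hr 2]
    _ = ENNReal.ofReal ((1 + r) ^ 3) * volume U - volume U := by
        rw [ENNReal.ofReal_sub _ zero_le_one, ENNReal.sub_mul]
        · simp
        · intros; exact hUfin
    _ ≤ volume ((Ioo (0 : ℝ) (1 + r) • ((↑) '' A : Set 𝔼)) \ U) := by
        rw [← hV]; exact le_measure_sdiff
    _ ≤ _ := by
        refine measure_mono ?_
        rintro _ ⟨⟨s, hs, _, ⟨ω, hω, rfl⟩, rfl⟩, hn⟩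
        have hn1 : ‖s • (ω : 𝔼)‖ = s := by
          simp [norm_smul, abs_of_pos hs.1]
        simp only [mem_ofPred_eq, hn1]
        refine ⟨?_, hs.2.le, ω, hω, rfl⟩
        by_contra! h
        exact hn ⟨s, ⟨hs.1, h⟩, _, ⟨ω, hω, rfl⟩, rfl⟩

/-- Spherical caps of radius `r` have surface measure `O(r²)`. -/
theorem exists_sphereMeasure_cap_le : ∃ C : ℝ≥0, ∀ (z : 𝔼) (r : ℝ),
    0 < r → r ≤ 1 →
    sphereMeasure {ω | ‖z + (ω : 𝔼)‖ ≤ r} ≤ C * ENNReal.ofReal (r ^ 2) := by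
  obtain ⟨K, hK⟩ : ∃ K : ℝ≥0, (K : ℝ≥0∞) =
      volume (Metric.closedBall (0 : 𝔼) 1) :=
    ⟨_, ENNReal.coe_toNNReal (measure_closedBall_lt_top).ne⟩
  -- The thickened cap lies in a ball of radius `2r`, of volume `8 K r³`; one factor `r` is then
  -- divided out.
  refine ⟨8 * K, fun z r hr hr1 => ?_⟩
  have hm : MeasurableSet {ω : 𝕊 |
      ‖z + (ω : 𝔼)‖ ≤ r} := by
    apply measurableSet_le <;> fun_prop
  have h := ofReal_mul_sphereMeasure_le hm hr.le
  have h2 : volume {y : 𝔼 | 1 ≤ ‖y‖ ∧ ‖y‖ ≤ 1 + r ∧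
      ∃ ω ∈ {ω : 𝕊 |
        ‖z + (ω : 𝔼)‖ ≤ r}, y = ‖y‖ • (ω : 𝔼)} ≤
      volume (Metric.closedBall (-z) (2 * r)) := by
    refine measure_mono ?_
    rintro y ⟨h1, h1', ω, hω, hy⟩
    simp only [Set.mem_ofPred_eq] at hω
    rw [Metric.mem_closedBall, dist_eq_norm, hy]
    have : ‖y‖ • (ω : 𝔼) - -z = (‖y‖ - 1) • (ω : 𝔼)
      + (z + ω) := by module
    rw [this]
    refine (norm_add_le _ _).trans ?_
    rw [norm_smul, Real.norm_eq_abs, abs_of_nonneg (by linarith)]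
    simp only [norm_eq_of_mem_sphere]
    linarith
  rw [Measure.addHaar_closedBall' _ _ (by positivity), ← hK] at h2
  have h3 := h.trans h2
  have hr0 : ENNReal.ofReal r ≠ 0 := by simpa using hr
  rw [← ENNReal.mul_le_mul_iff_right hr0 ENNReal.ofReal_ne_top]
  refine h3.trans (le_of_eq ?_)
  have : (2 * r) ^ Module.finrank ℝ (𝔼) = 8 * (r * r ^ 2) := by
    simp; ring
  rw [this, ENNReal.ofReal_mul (by norm_num), ENNReal.ofReal_mul hr.le]
  push_cast
  simp
  ring

/-- The area depends only on the difference of the squared radii. This is what makes all parallel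
slices of a spherical shell comparable. Negative `a` is allowed because a slice may miss the inner
ball. -/
theorem volume_annulus_fin_two_le (a b : ℝ) (hab : a ≤ b) :
    volume {v : EuclideanSpace ℝ (Fin 2) | a ≤ ‖v‖ ^ 2 ∧ ‖v‖ ^ 2 ≤ b} ≤
      ENNReal.ofReal (Real.pi * (b - a)) := by
  rcases lt_or_ge b 0 with hb | hb
  · have : {v : EuclideanSpace ℝ (Fin 2) | a ≤ ‖v‖ ^ 2 ∧ ‖v‖ ^ 2 ≤ b} = ∅ := by
      ext v; simp; intro _; nlinarith [sq_nonneg ‖v‖]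
    simp [this]
  have hsub : {v : EuclideanSpace ℝ (Fin 2) | a ≤ ‖v‖ ^ 2 ∧ ‖v‖ ^ 2 ≤ b} ⊆
      Metric.closedBall 0 (√b) \ Metric.ball 0 (√a) := by
    rintro v ⟨h1, h2⟩
    simp only [Set.mem_sdiff, Metric.mem_closedBall, dist_zero_right, Metric.mem_ball, not_lt]
    exact ⟨Real.le_sqrt_of_sq_le h2, Real.sqrt_le_iff.2 ⟨norm_nonneg _, h1⟩⟩
  refine (measure_mono hsub).trans ?_
  rw [measure_sdiff (Metric.ball_subset_closedBall.trans
    (Metric.closedBall_subset_closedBall (Real.sqrt_le_sqrt hab)))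
    measurableSet_ball.nullMeasurableSet measure_ball_lt_top.ne]
  rw [EuclideanSpace.volume_closedBall_fin_two, EuclideanSpace.volume_ball_fin_two]
  rw [← ENNReal.sub_mul (by simp), mul_comm, ENNReal.ofReal_mul Real.pi_pos.le,
    ← ENNReal.ofReal_pow (by positivity), ← ENNReal.ofReal_pow (by positivity), Real.sq_sqrt hb,
    ← ENNReal.ofReal_sub _ (by positivity)]
  gcongr
  rcases le_or_gt 0 a with ha | ha
  · rw [Real.sq_sqrt ha]
  · rw [Real.sqrt_eq_zero_of_nonpos ha.le]; linarith

/-- Slice orthogonally to `e`: at height `t` the squared radii run from `1 - t²` to `(1 + r)² - t²`,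
so the bound on the area is independent of `t`, as in Archimedes' hat-box theorem. -/
theorem volume_slab_inter_shell_le {e : 𝔼} (he : ‖e‖ = 1) (α δ : ℝ)
    {r : ℝ} (hr : 0 ≤ r) :
    volume {y : 𝔼 | |inner ℝ e y - α| ≤ δ ∧ 1 ≤ ‖y‖ ∧ ‖y‖ ≤ 1 + r} ≤
      ENNReal.ofReal (2 * δ) * ENNReal.ofReal (Real.pi * ((1 + r) ^ 2 - 1)) := by
  obtain ⟨b, hb⟩ := Orthonormal.exists_orthonormalBasis_extension_of_card_eq (𝕜 := ℝ)
    (E := 𝔼) (ι := Fin 3) (by simp) (v := fun _ => e) (s := {0}) (by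
      rw [orthonormal_iff_ite]
      rintro ⟨i, rfl⟩ ⟨j, rfl⟩
      simp [he])
  have hb0 : b 0 = e := hb 0 rfl
  set Φ : 𝔼 → ℝ × EuclideanSpace ℝ (Fin 2) :=
    fun y => (b.repr y 0, WithLp.toLp 2 fun i : Fin 2 => b.repr y i.succ) with hΦdef
  have hΦ : MeasurePreserving Φ volume (volume.prod volume) := by
    have h1 := (PiLp.volume_preserving_ofLp (Fin 3)).comp b.measurePreserving_repr
    have h2 := (volume_preserving_piFinSuccAbove (fun _ : Fin 3 => ℝ) 0).comp h1
    have h3 : MeasurePreserving (Prod.map id (WithLp.toLp 2) :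
        ℝ × (Fin 2 → ℝ) → ℝ × EuclideanSpace ℝ (Fin 2)) (volume.prod volume)
        (volume.prod volume) :=
      (MeasurePreserving.id volume).prod (PiLp.volume_preserving_toLp (Fin 2))
    exact h3.comp h2
  set T : Set (ℝ × EuclideanSpace ℝ (Fin 2)) := {q | |q.1 - α| ≤ δ ∧
    1 - q.1 ^ 2 ≤ ‖q.2‖ ^ 2 ∧ ‖q.2‖ ^ 2 ≤ (1 + r) ^ 2 - q.1 ^ 2} with hT
  have hTm : MeasurableSet T := by
    have h1 : MeasurableSet {q : ℝ × EuclideanSpace ℝ (Fin 2) | |q.1 - α| ≤ δ} :=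
      measurableSet_le (by fun_prop) (by fun_prop)
    have h2 : MeasurableSet {q : ℝ × EuclideanSpace ℝ (Fin 2) | 1 - q.1 ^ 2 ≤ ‖q.2‖ ^ 2} :=
      measurableSet_le (by fun_prop) (by fun_prop)
    have h3 : MeasurableSet {q : ℝ × EuclideanSpace ℝ (Fin 2) |
        ‖q.2‖ ^ 2 ≤ (1 + r) ^ 2 - q.1 ^ 2} :=
      measurableSet_le (by fun_prop) (by fun_prop)
    exact h1.inter (h2.inter h3)
  calc _ ≤ volume (Φ ⁻¹' T) := by
        refine measure_mono (fun y hy => ?_)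
        obtain ⟨h1, h2, h3⟩ := hy
        have hn : ‖y‖ ^ 2 = (b.repr y 0) ^ 2 +
            ‖(WithLp.toLp 2 fun i : Fin 2 => b.repr y i.succ : EuclideanSpace ℝ (Fin 2))‖ ^ 2 := by
          rw [← b.repr.norm_map y, EuclideanSpace.norm_sq_eq, EuclideanSpace.norm_sq_eq,
            Fin.sum_univ_succ]
          simp
        refine ⟨?_, ?_, ?_⟩
        · simpa [hΦdef, b.repr_apply_apply, hb0] using h1
        · simp only [hΦdef]; nlinarith [norm_nonneg y]
        · simp only [hΦdef]; nlinarith [norm_nonneg y]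
    _ = (volume.prod volume) T := by
        rw [← hΦ.measure_preimage hTm.nullMeasurableSet]
    _ = ∫⁻ t, volume (Prod.mk t ⁻¹' T) := Measure.prod_apply hTm
    _ ≤ ∫⁻ t in Set.Icc (α - δ) (α + δ), ENNReal.ofReal (Real.pi * ((1 + r) ^ 2 - 1)) := by
        rw [← lintegral_indicator measurableSet_Icc]
        refine lintegral_mono fun t => ?_
        by_cases ht : t ∈ Set.Icc (α - δ) (α + δ)
        · rw [Set.indicator_of_mem ht]
          refine (measure_mono (fun v hv => hv.2)).trans ((volume_annulus_fin_two_le (1 - t ^ 2)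
            ((1 + r) ^ 2 - t ^ 2) (by nlinarith)).trans (le_of_eq ?_))
          ring_nf
        · rw [Set.indicator_of_notMem ht, nonpos_iff_eq_zero]
          have : Prod.mk t ⁻¹' T = ∅ := by
            ext v
            simp only [Set.mem_preimage, hT, Set.mem_ofPred_eq, Set.mem_empty_iff_false, iff_false]
            rintro ⟨h, -⟩
            rw [abs_le] at h
            exact ht ⟨by linarith, by linarith⟩
          rw [this, measure_empty]
    _ = _ := by
        rw [setLIntegral_const, Real.volume_Icc, mul_comm]
        ring_nf

/-- Bands of width `2 r / ‖x‖` on the sphere have surface measure `O(r / ‖x‖)`. -/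
theorem exists_sphereMeasure_band_le : ∃ C : ℝ≥0, ∀ (x : 𝔼) (α r : ℝ),
    0 < r → r ≤ 1 → ‖x‖ ≤ 2 →
    ENNReal.ofReal ‖x‖ * sphereMeasure {ω | |inner ℝ x (ω : 𝔼) - α| ≤ r} ≤
      C * ENNReal.ofReal r := by
  -- The thickened band lies in a slab of half-width `3r / ‖x‖`: moving radially by at most `r`
  -- changes the inner product with `x` by at most `2r`. With `(1 + r)² - 1 ≤ 3r` the volume is at
  -- most `18π r² / ‖x‖`.
  refine ⟨⟨Real.pi * 18, by positivity⟩, fun x α r hr hr1 hx => ?_⟩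
  rcases eq_or_ne x 0 with rfl | hx0
  · simp
  have hxn : 0 < ‖x‖ := norm_pos_iff.2 hx0
  have hm : MeasurableSet {ω : 𝕊 |
      |inner ℝ x (ω : 𝔼) - α| ≤ r} := by
    apply measurableSet_le <;> fun_prop
  have h := ofReal_mul_sphereMeasure_le hm hr.le
  have h2 : volume {y : 𝔼 | 1 ≤ ‖y‖ ∧ ‖y‖ ≤ 1 + r ∧
      ∃ ω ∈ {ω : 𝕊 |
        |inner ℝ x (ω : 𝔼) - α| ≤ r},
        y = ‖y‖ • (ω : 𝔼)} ≤ _ :=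
    (measure_mono ?_).trans (volume_slab_inter_shell_le (e := ‖x‖⁻¹ • x)
      (by simp [norm_smul, hxn.ne']) (‖x‖⁻¹ * α) (‖x‖⁻¹ * (3 * r)) hr.le)
  · have h3 := h.trans h2
    have hr0 : ENNReal.ofReal r ≠ 0 := by simpa using hr
    rw [← ENNReal.mul_le_mul_iff_right hr0 ENNReal.ofReal_ne_top]
    calc _ = ENNReal.ofReal ‖x‖ * (ENNReal.ofReal r * sphereMeasure
            {ω | |inner ℝ x (ω : 𝔼) - α| ≤ r}) := by ring
      _ ≤ ENNReal.ofReal ‖x‖ * _ := mul_le_mul_right h3 _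
      _ = ENNReal.ofReal (‖x‖ * (2 * (‖x‖⁻¹ * (3 * r)) * (Real.pi * ((1 + r) ^ 2 - 1)))) := by
        rw [ENNReal.ofReal_mul hxn.le, ENNReal.ofReal_mul (p := 2 * (‖x‖⁻¹ * (3 * r))) (by positivity)]
      _ ≤ ENNReal.ofReal (r * (Real.pi * 18 * r)) := by
        refine ENNReal.ofReal_le_ofReal ?_
        have : ‖x‖ * (2 * (‖x‖⁻¹ * (3 * r)) * (Real.pi * ((1 + r) ^ 2 - 1))) =
          Real.pi * (6 * r * ((1 + r) ^ 2 - 1)) := by field_simp; ring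
        rw [this]
        have : r * (Real.pi * 18 * r) = Real.pi * (18 * r * r) := by ring
        rw [this]
        refine mul_le_mul_of_nonneg_left ?_ Real.pi_pos.le
        nlinarith [mul_pos hr hr]
      _ = _ := by
        rw [ENNReal.ofReal_mul hr.le, ENNReal.ofReal_mul (by positivity)]
        congr 2
        exact ENNReal.ofReal_eq_coe_nnreal _
  · rintro y ⟨h1, h1', ω, hω, hy⟩
    refine ⟨?_, h1, h1'⟩
    simp only [Set.mem_ofPred_eq] at hω
    have : inner ℝ (‖x‖⁻¹ • x) y - ‖x‖⁻¹ * α = ‖x‖⁻¹ *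
        ((‖y‖ - 1) * inner ℝ x (ω : 𝔼) + (inner ℝ x (ω : 𝔼) - α)) := by
      conv_lhs => rw [hy]
      rw [real_inner_smul_left, real_inner_smul_right]; ring
    rw [this, abs_mul, abs_of_pos (inv_pos.2 hxn)]
    gcongr
    have hin : |inner ℝ x (ω : 𝔼)| ≤ 2 :=
      (abs_real_inner_le_norm _ _).trans (by simpa using hx)
    calc _ ≤ |(‖y‖ - 1) * inner ℝ x (ω : 𝔼)| + _ := abs_add_le _ _
      _ ≤ r * 2 + r := by
        rw [abs_mul, abs_of_nonneg (by linarith : 0 ≤ ‖y‖ - 1)]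
        gcongr
        linarith
      _ = 3 * r := by ring

/-! ### The self-convolution of surface measure -/

/-- The indicator function of the closed ball of radius `r` centred at the origin. -/
noncomputable def ballInd (r : ℝ) : 𝔼 → ℝ≥0∞ :=
  (Metric.closedBall 0 r).indicator 1

theorem ballInd_apply (r : ℝ) (x : 𝔼) [Decidable (‖x‖ ≤ r)] :
    ballInd r x = if ‖x‖ ≤ r then 1 else 0 := by
  simp [ballInd, Set.indicator]

@[fun_prop]
theorem measurable_ballInd (r : ℝ) : Measurable (ballInd r) :=
  measurable_one.indicator measurableSet_closedBall

theorem lintegral_ballInd_add (z : 𝔼) (r : ℝ) :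
    ∫⁻ d, ballInd r (z + (d : 𝔼)) ∂sphereMeasure =
    sphereMeasure {ω | ‖z + (ω : 𝔼)‖ ≤ r} := by
  have hm : MeasurableSet {ω : 𝕊 |
      ‖z + (ω : 𝔼)‖ ≤ r} := by
    apply measurableSet_le <;> fun_prop
  rw [← lintegral_indicator_one hm]
  congr with d
  classical
  simp [Set.indicator, ballInd_apply]

instance : IsFiniteMeasure sphereMeasure := by unfold sphereMeasure; infer_instance

/-- The `r`-neighbourhood of `-x` has mass `O(r²)` and `O(r³ / ‖x‖)` for the convolution of the
surface measure of the sphere with itself. -/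
theorem exists_lintegral_ball_sphere_conv_le : ∃ C : ℝ≥0, ∀ (x : 𝔼) (r : ℝ),
    0 < r → r ≤ 1 / 2 → ‖x‖ ≤ 2 →
    (∫⁻ c, ∫⁻ d, ballInd r (x + c + d) ∂sphereMeasure ∂sphereMeasure ≤ C * ENNReal.ofReal (r ^ 2)) ∧
    ENNReal.ofReal ‖x‖ * ∫⁻ c, ∫⁻ d, ballInd r (x + c + d) ∂sphereMeasure ∂sphereMeasure ≤ C * ENNReal.ofReal (r ^ 3) := by
  obtain ⟨C₁, hC₁⟩ := exists_sphereMeasure_cap_le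
  obtain ⟨C₂, hC₂⟩ := exists_sphereMeasure_band_le
  obtain ⟨K, hK⟩ : ∃ K : ℝ≥0, (K : ℝ≥0∞) = sphereMeasure Set.univ :=
    ⟨_, ENNReal.coe_toNNReal (measure_lt_top _ _).ne⟩
  refine ⟨C₁ * K + 2 * C₁ * C₂, fun x r hr hr1 hx => ⟨?_, ?_⟩⟩
  · simp_rw [lintegral_ballInd_add]
    calc _ ≤ ∫⁻ c, C₁ * ENNReal.ofReal (r ^ 2) ∂sphereMeasure :=
          lintegral_mono fun c => hC₁ _ r hr (by linarith)
      _ = (C₁ * K : ℝ≥0) * ENNReal.ofReal (r ^ 2) := by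
          rw [lintegral_const, ← hK]; push_cast; ring
      _ ≤ _ := by gcongr; exact le_self_add
  · simp_rw [lintegral_ballInd_add]
    -- A nonempty inner cap forces `|‖x + c‖ - 1| ≤ r`; squaring confines `c` to this band. A band
    -- of size `r / ‖x‖` times a cap of size `r²` gives the second bound.
    set B : Set 𝕊 :=
      {ω | |inner ℝ x (ω : 𝔼) - (-(‖x‖ ^ 2 / 2))| ≤ 3 / 2 * r} with hB
    have hBm : MeasurableSet B := by
      apply measurableSet_le <;> fun_prop
    calc _ ≤ ENNReal.ofReal ‖x‖ * ∫⁻ c, B.indicator (fun _ => C₁ * ENNReal.ofReal (r ^ 2)) c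
            ∂sphereMeasure := by
          gcongr with c
          by_cases hc : c ∈ B
          · rw [Set.indicator_of_mem hc]
            exact hC₁ _ r hr (by linarith)
          · rw [Set.indicator_of_notMem hc, nonpos_iff_eq_zero]
            have : {ω : 𝕊 |
                ‖x + c + (ω : 𝔼)‖ ≤ r} = ∅ := by
              ext d
              simp only [Set.mem_ofPred_eq, Set.mem_empty_iff_false, iff_false]
              intro h
              refine hc ?_
              have h1 : |‖x + c‖ - 1| ≤ r := by
                have := abs_norm_sub_norm_le (x + c) (-(d : 𝔼))
                simp only [norm_neg, norm_eq_of_mem_sphere, sub_neg_eq_add] at this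
                linarith
              have h2 : ‖x + c‖ ^ 2 = ‖x‖ ^ 2 + 2 * inner ℝ x (c : 𝔼) + 1 := by
                rw [norm_add_sq_real]; simp
              simp only [hB, Set.mem_ofPred_eq]
              rw [abs_le] at h1 ⊢
              constructor <;> nlinarith [norm_nonneg (x + c)]
            rw [this, measure_empty]
      _ = C₁ * ENNReal.ofReal (r ^ 2) * (ENNReal.ofReal ‖x‖ * sphereMeasure B) := by
          rw [lintegral_indicator_const hBm]; ring
      _ ≤ C₁ * ENNReal.ofReal (r ^ 2) * (C₂ * ENNReal.ofReal (3 / 2 * r)) := by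
          exact mul_le_mul_right (hC₂ x _ (3 / 2 * r) (by linarith) (by linarith) hx) _
      _ ≤ C₁ * ENNReal.ofReal (r ^ 2) * (C₂ * ENNReal.ofReal (2 * r)) := by
          gcongr; norm_num
      _ = (2 * C₁ * C₂ : ℝ≥0) * ENNReal.ofReal (r ^ 3) := by
          rw [pow_succ r 2, ENNReal.ofReal_mul (p := r ^ 2) (by positivity),
            ENNReal.ofReal_mul (p := 2) (by positivity)]
          push_cast; simp; ring
      _ ≤ _ := by gcongr; exact le_add_self

theorem ENNReal.two_mul_ofReal (x : ℝ) : 2 * ENNReal.ofReal x = ENNReal.ofReal (2 * x) := by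
  rw [ENNReal.ofReal_mul two_pos.le]; simp

/-! ### Rearranging fourfold integrals -/

section FourfoldIntegrals

variable {X : Type*} [MeasurableSpace X] {ν : Measure X} [SFinite ν] {F : X → X → X → X → ℝ≥0∞}

theorem lintegral_four_swap_left
    (hF : Measurable fun p : X × X × X × X => F p.1 p.2.1 p.2.2.1 p.2.2.2) :
    ∫⁻ a, ∫⁻ b, ∫⁻ c, ∫⁻ d, F a b c d ∂ν ∂ν ∂ν ∂ν = ∫⁻ a, ∫⁻ b, ∫⁻ c, ∫⁻ d, F b a c d ∂ν ∂ν ∂ν ∂ν := by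
  refine lintegral_lintegral_swap (f := fun a b => ∫⁻ c, ∫⁻ d, F a b c d ∂ν ∂ν) ?_
  refine (Measurable.lintegral_prod_right ?_).aemeasurable
  refine Measurable.lintegral_prod_right ?_
  exact hF.comp (by fun_prop : Measurable fun p : ((X × X) × X) × X =>
    (p.1.1.1, p.1.1.2, p.1.2, p.2))

theorem lintegral_four_swap_middle
    (hF : Measurable fun p : X × X × X × X => F p.1 p.2.1 p.2.2.1 p.2.2.2) :
    ∫⁻ a, ∫⁻ b, ∫⁻ c, ∫⁻ d, F a b c d ∂ν ∂ν ∂ν ∂ν = ∫⁻ a, ∫⁻ b, ∫⁻ c, ∫⁻ d, F a c b d ∂ν ∂ν ∂ν ∂ν := by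
  refine lintegral_congr fun a => ?_
  refine lintegral_lintegral_swap (f := fun b c => ∫⁻ d, F a b c d ∂ν) ?_
  refine (Measurable.lintegral_prod_right ?_).aemeasurable
  exact hF.comp (by fun_prop : Measurable fun p : (X × X) × X => (a, p.1.1, p.1.2, p.2))

theorem lintegral_four_swap_right
    (hF : Measurable fun p : X × X × X × X => F p.1 p.2.1 p.2.2.1 p.2.2.2) :
    ∫⁻ a, ∫⁻ b, ∫⁻ c, ∫⁻ d, F a b c d ∂ν ∂ν ∂ν ∂ν = ∫⁻ a, ∫⁻ b, ∫⁻ c, ∫⁻ d, F a b d c ∂ν ∂ν ∂ν ∂ν := by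
  refine lintegral_congr fun a => lintegral_congr fun b => ?_
  refine lintegral_lintegral_swap (f := fun c d => F a b c d) ?_
  exact (hF.comp (by fun_prop : Measurable fun p : X × X => (a, b, p.1, p.2))).aemeasurable

theorem lintegral_four_swap_pairs
    (hF : Measurable fun p : X × X × X × X => F p.1 p.2.1 p.2.2.1 p.2.2.2) :
    ∫⁻ a, ∫⁻ b, ∫⁻ c, ∫⁻ d, F a b c d ∂ν ∂ν ∂ν ∂ν = ∫⁻ a, ∫⁻ b, ∫⁻ c, ∫⁻ d, F c d a b ∂ν ∂ν ∂ν ∂ν := by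
  rw [lintegral_four_swap_middle hF, lintegral_four_swap_left (F := fun a b c d => F a c b d),
    lintegral_four_swap_right (F := fun a b c d => F b c a d),
    lintegral_four_swap_middle (F := fun a b c d => F b d a c)]
  · exact hF.comp (by fun_prop : Measurable fun p : X × X × X × X => (p.2.1, p.2.2.2, p.1, p.2.2.1))
  · exact hF.comp (by fun_prop : Measurable fun p : X × X × X × X => (p.2.1, p.2.2.1, p.1, p.2.2.2))
  · exact hF.comp (by fun_prop : Measurable fun p : X × X × X × X => (p.1, p.2.2.1, p.2.1, p.2.2.2))

theorem lintegral_four_add_left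
    (hF : Measurable fun p : X × X × X × X => F p.1 p.2.1 p.2.2.1 p.2.2.2)
    (G : X → X → X → X → ℝ≥0∞) :
    ∫⁻ a, ∫⁻ b, ∫⁻ c, ∫⁻ d, F a b c d + G a b c d ∂ν ∂ν ∂ν ∂ν =
      ∫⁻ a, ∫⁻ b, ∫⁻ c, ∫⁻ d, F a b c d ∂ν ∂ν ∂ν ∂ν +
        ∫⁻ a, ∫⁻ b, ∫⁻ c, ∫⁻ d, G a b c d ∂ν ∂ν ∂ν ∂ν := by
  have h3 : Measurable fun p : (X × X) × X => ∫⁻ d, F p.1.1 p.1.2 p.2 d ∂ν :=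
    Measurable.lintegral_prod_right (hF.comp (by fun_prop :
      Measurable fun p : ((X × X) × X) × X => (p.1.1.1, p.1.1.2, p.1.2, p.2)))
  have h2 : Measurable fun p : X × X => ∫⁻ c, ∫⁻ d, F p.1 p.2 c d ∂ν ∂ν :=
    Measurable.lintegral_prod_right h3
  have h1 : Measurable fun a => ∫⁻ b, ∫⁻ c, ∫⁻ d, F a b c d ∂ν ∂ν ∂ν :=
    Measurable.lintegral_prod_right h2
  rw [← lintegral_add_left h1]
  refine lintegral_congr fun a => ?_
  have h2' : Measurable fun b => ∫⁻ c, ∫⁻ d, F a b c d ∂ν ∂ν :=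
    h2.comp (by fun_prop : Measurable fun b : X => (a, b))
  rw [← lintegral_add_left h2']
  refine lintegral_congr fun b => ?_
  have h3' : Measurable fun c => ∫⁻ d, F a b c d ∂ν :=
    h3.comp (by fun_prop : Measurable fun c : X => ((a, b), c))
  rw [← lintegral_add_left h3']
  refine lintegral_congr fun c => ?_
  have hF' : Measurable fun d => F a b c d :=
    hF.comp (by fun_prop : Measurable fun d : X => (a, b, c, d))
  rw [← lintegral_add_left hF']

theorem lintegral_four_const_mul (k : ℝ≥0∞)
    (hF : Measurable fun p : X × X × X × X => F p.1 p.2.1 p.2.2.1 p.2.2.2) :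
    ∫⁻ a, ∫⁻ b, ∫⁻ c, ∫⁻ d, k * F a b c d ∂ν ∂ν ∂ν ∂ν =
      k * ∫⁻ a, ∫⁻ b, ∫⁻ c, ∫⁻ d, F a b c d ∂ν ∂ν ∂ν ∂ν := by
  have h3 : Measurable fun p : (X × X) × X => ∫⁻ d, F p.1.1 p.1.2 p.2 d ∂ν :=
    Measurable.lintegral_prod_right (hF.comp (by fun_prop :
      Measurable fun p : ((X × X) × X) × X => (p.1.1.1, p.1.1.2, p.1.2, p.2)))
  have h2 : Measurable fun p : X × X => ∫⁻ c, ∫⁻ d, F p.1 p.2 c d ∂ν ∂ν :=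
    Measurable.lintegral_prod_right h3
  have h1 : Measurable fun a => ∫⁻ b, ∫⁻ c, ∫⁻ d, F a b c d ∂ν ∂ν ∂ν :=
    Measurable.lintegral_prod_right h2
  rw [← lintegral_const_mul k h1]
  refine lintegral_congr fun a => ?_
  have h2' : Measurable fun b => ∫⁻ c, ∫⁻ d, F a b c d ∂ν ∂ν :=
    h2.comp (by fun_prop : Measurable fun b : X => (a, b))
  rw [← lintegral_const_mul k h2']
  refine lintegral_congr fun b => ?_
  have h3' : Measurable fun c => ∫⁻ d, F a b c d ∂ν :=
    h3.comp (by fun_prop : Measurable fun c : X => ((a, b), c))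
  rw [← lintegral_const_mul k h3']
  refine lintegral_congr fun c => ?_
  have hF' : Measurable fun d => F a b c d :=
    hF.comp (by fun_prop : Measurable fun d : X => (a, b, c, d))
  rw [← lintegral_const_mul k hF']

end FourfoldIntegrals

/-! ### The fourfold estimate on the sphere -/

/-- For four unit vectors, the squared lengths of the pairwise sums add up to at least `8`. -/
theorem eight_le_sum_norm_add_sq {V : Type*} [NormedAddCommGroup V] [InnerProductSpace ℝ V]
    {a b c d : V} (ha : ‖a‖ = 1) (hb : ‖b‖ = 1) (hc : ‖c‖ = 1) (hd : ‖d‖ = 1) :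
    8 ≤ ‖a + b‖ ^ 2 + ‖a + c‖ ^ 2 + ‖a + d‖ ^ 2 + ‖b + c‖ ^ 2 + ‖b + d‖ ^ 2 + ‖c + d‖ ^ 2 := by
  have h := sq_nonneg ‖a + b + c + d‖
  have key : ‖a + b + c + d‖ ^ 2 + 8 =
      ‖a + b‖ ^ 2 + ‖a + c‖ ^ 2 + ‖a + d‖ ^ 2 + ‖b + c‖ ^ 2 + ‖b + d‖ ^ 2 + ‖c + d‖ ^ 2 := by
    simp only [norm_add_sq_real, inner_add_left, ha, hb, hc, hd]
    ring
  linarith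

/-- The fourfold weight `g(a) g(b) g(c) g(d) 1_{|a + b + c + d| ≤ r}` on the sphere. -/
noncomputable def quadWeight (g : 𝕊 → ℝ≥0∞) (r : ℝ) (a b c d : 𝕊) : ℝ≥0∞ :=
  g a * g b * (g c * g d) * ballInd r ((a : 𝔼) + b + c + d)

theorem quadWeight_swap_left (g : 𝕊 → ℝ≥0∞) (r : ℝ) (a b c d : 𝕊) :
    quadWeight g r b a c d = quadWeight g r a b c d := by
  unfold quadWeight
  rw [show (b : 𝔼) + a + c + d = a + b + c + d by abel]
  ring

theorem quadWeight_swap_middle (g : 𝕊 → ℝ≥0∞) (r : ℝ) (a b c d : 𝕊) :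
    quadWeight g r a c b d = quadWeight g r a b c d := by
  unfold quadWeight
  rw [show (a : 𝔼) + c + b + d = a + b + c + d by abel]
  ring

theorem quadWeight_swap_right (g : 𝕊 → ℝ≥0∞) (r : ℝ) (a b c d : 𝕊) :
    quadWeight g r a b d c = quadWeight g r a b c d := by
  unfold quadWeight
  rw [show (a : 𝔼) + b + d + c = a + b + c + d by abel]
  ring

@[fun_prop]
theorem Measurable.quadWeight {Y : Type*} [MeasurableSpace Y] {g : 𝕊 → ℝ≥0∞} (hg : Measurable g)
    (r : ℝ) {a b c d : Y → 𝕊} (ha : Measurable a) (hb : Measurable b) (hc : Measurable c)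
    (hd : Measurable d) : Measurable fun y => quadWeight g r (a y) (b y) (c y) (d y) := by
  unfold _root_.quadWeight
  have h : Measurable fun y => (a y : 𝔼) + b y + c y + d y := by fun_prop
  have h' := (measurable_ballInd r).comp h
  exact (((hg.comp ha).mul (hg.comp hb)).mul ((hg.comp hc).mul (hg.comp hd))).mul h'

/-- The weight is symmetric in its four arguments, so each of the six pairs contributes equally to
the integral of the sum of squared pair sums. The inserted factor vanishes exactly where `σ * σ` is
singular. -/
theorem eight_mul_lintegral_quadWeight_le {g : 𝕊 → ℝ≥0∞} (hg : Measurable g) (r : ℝ) :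
    8 * ∫⁻ a, ∫⁻ b, ∫⁻ c, ∫⁻ d, quadWeight g r a b c d
      ∂sphereMeasure ∂sphereMeasure ∂sphereMeasure ∂sphereMeasure ≤
    6 * ∫⁻ a, ∫⁻ b, ∫⁻ c, ∫⁻ d, ENNReal.ofReal (‖(a : 𝔼) + b‖ ^ 2) * quadWeight g r a b c d
      ∂sphereMeasure ∂sphereMeasure ∂sphereMeasure ∂sphereMeasure := by
  set w := quadWeight g r with hw
  set q : 𝕊 → 𝕊 → ℝ≥0∞ := fun a b => ENNReal.ofReal (‖(a : 𝔼) + b‖ ^ 2) with hq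
  have hqm {Y : Type} [MeasurableSpace Y] {a b : Y → 𝕊} (ha : Measurable a) (hb : Measurable b) :
      Measurable fun y => q (a y) (b y) := by
    simp only [hq]; fun_prop
  have hwm {Y : Type} [MeasurableSpace Y] {a b c d : Y → 𝕊} (ha : Measurable a) (hb : Measurable b)
      (hc : Measurable c) (hd : Measurable d) : Measurable fun y => w (a y) (b y) (c y) (d y) :=
    hg.quadWeight r ha hb hc hd
  set J : (𝕊 → 𝕊 → 𝕊 → 𝕊 → ℝ≥0∞) → ℝ≥0∞ := fun F => ∫⁻ a, ∫⁻ b, ∫⁻ c, ∫⁻ d, F a b c d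
      ∂sphereMeasure ∂sphereMeasure ∂sphereMeasure ∂sphereMeasure with hJ
  have h13 : J (fun a b c d => q a c * w a b c d) = J (fun a b c d => q a b * w a b c d) := by
    simp only [hJ]
    rw [lintegral_four_swap_middle]
    · simp only [hw, quadWeight_swap_middle]
    · exact (hqm (by fun_prop) (by fun_prop)).mul
        (hwm (by fun_prop) (by fun_prop) (by fun_prop) (by fun_prop))
  have h14 : J (fun a b c d => q a d * w a b c d) = J (fun a b c d => q a b * w a b c d) := by
    rw [← h13]
    simp only [hJ]
    rw [lintegral_four_swap_right]
    · simp only [hw, quadWeight_swap_right]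
    · exact (hqm (by fun_prop) (by fun_prop)).mul
        (hwm (by fun_prop) (by fun_prop) (by fun_prop) (by fun_prop))
  have h23 : J (fun a b c d => q b c * w a b c d) = J (fun a b c d => q a b * w a b c d) := by
    rw [← h13]
    simp only [hJ]
    rw [lintegral_four_swap_left]
    · simp only [hw, quadWeight_swap_left]
    · exact (hqm (by fun_prop) (by fun_prop)).mul
        (hwm (by fun_prop) (by fun_prop) (by fun_prop) (by fun_prop))
  have h24 : J (fun a b c d => q b d * w a b c d) = J (fun a b c d => q a b * w a b c d) := by
    rw [← h14]
    simp only [hJ]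
    rw [lintegral_four_swap_left]
    · simp only [hw, quadWeight_swap_left]
    · exact (hqm (by fun_prop) (by fun_prop)).mul
        (hwm (by fun_prop) (by fun_prop) (by fun_prop) (by fun_prop))
  have h34 : J (fun a b c d => q c d * w a b c d) = J (fun a b c d => q a b * w a b c d) := by
    rw [← h24]
    simp only [hJ]
    rw [lintegral_four_swap_middle]
    · simp only [hw, quadWeight_swap_middle]
    · exact (hqm (by fun_prop) (by fun_prop)).mul
        (hwm (by fun_prop) (by fun_prop) (by fun_prop) (by fun_prop))
  have hadd (F G : 𝕊 → 𝕊 → 𝕊 → 𝕊 → ℝ≥0∞)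
      (hF : Measurable fun p : 𝕊 × 𝕊 × 𝕊 × 𝕊 => F p.1 p.2.1 p.2.2.1 p.2.2.2) :
      J (fun a b c d => F a b c d + G a b c d) = J F + J G := lintegral_four_add_left hF G
  have hmul (k : ℝ≥0∞) (F : 𝕊 → 𝕊 → 𝕊 → 𝕊 → ℝ≥0∞)
      (hF : Measurable fun p : 𝕊 × 𝕊 × 𝕊 × 𝕊 => F p.1 p.2.1 p.2.2.1 p.2.2.2) :
      J (fun a b c d => k * F a b c d) = k * J F := lintegral_four_const_mul k hF
  calc 8 * J w = J fun a b c d => 8 * w a b c d :=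
        (hmul 8 w (hwm (by fun_prop) (by fun_prop) (by fun_prop) (by fun_prop))).symm
    _ ≤ J fun a b c d => q a b * w a b c d + (q a c * w a b c d + (q a d * w a b c d +
          (q b c * w a b c d + (q b d * w a b c d + q c d * w a b c d)))) := by
        refine lintegral_mono fun a => lintegral_mono fun b => lintegral_mono fun c =>
          lintegral_mono fun d => ?_
        simp only [← add_mul]
        gcongr
        simp only [hq]
        repeat rw [← ENNReal.ofReal_add (by positivity) (by positivity)]
        rw [← ENNReal.ofReal_ofNat 8]
        refine ENNReal.ofReal_le_ofReal ?_
        have := eight_le_sum_norm_add_sq (norm_eq_of_mem_sphere a) (norm_eq_of_mem_sphere b)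
          (norm_eq_of_mem_sphere c) (norm_eq_of_mem_sphere d)
        linarith
    _ = 6 * J fun a b c d => q a b * w a b c d := by
        have hm (i : 𝕊 × 𝕊 × 𝕊 × 𝕊 → 𝕊) (j : 𝕊 × 𝕊 × 𝕊 × 𝕊 → 𝕊) (hi : Measurable i)
            (hj : Measurable j) : Measurable fun p : 𝕊 × 𝕊 × 𝕊 × 𝕊 =>
            q (i p) (j p) * w p.1 p.2.1 p.2.2.1 p.2.2.2 :=
          (hqm hi hj).mul (hwm (by fun_prop) (by fun_prop) (by fun_prop) (by fun_prop))
        rw [hadd, hadd, hadd, hadd, hadd, h13, h14, h23, h24, h34]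
        · ring
        all_goals exact hm _ _ (by fun_prop) (by fun_prop)

/-- The `L²` fourfold estimate for the sphere, localised to quadruples with almost zero sum. -/
theorem exists_lintegral_quadWeight_le : ∃ C : ℝ≥0, ∀ (g : 𝕊 → ℝ≥0∞), Measurable g →
    ∀ r : ℝ, 0 < r → r ≤ 1 / 2 →
    ∫⁻ a, ∫⁻ b, ∫⁻ c, ∫⁻ d, quadWeight g r a b c d
      ∂sphereMeasure ∂sphereMeasure ∂sphereMeasure ∂sphereMeasure ≤
    C * ENNReal.ofReal (r ^ 3) * (∫⁻ a, g a ^ 2 ∂sphereMeasure) ^ 2 := by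
  obtain ⟨C, hC⟩ := exists_lintegral_ball_sphere_conv_le
  refine ⟨6 * C, fun g hg r hr hr1 => ?_⟩
  have hg2 : Measurable fun a => g a ^ 2 := hg.pow_const 2
  have hnorm (a b : 𝕊) : ‖(a : 𝔼) + b‖ ≤ 2 :=
    (norm_add_le _ _).trans (by simp only [norm_eq_of_mem_sphere]; norm_num)
  have hsq : ∫⁻ a, ∫⁻ b, g a ^ 2 * g b ^ 2 ∂sphereMeasure ∂sphereMeasure =
      (∫⁻ a, g a ^ 2 ∂sphereMeasure) ^ 2 := by
    simp_rw [lintegral_const_mul _ hg2]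
    rw [lintegral_mul_const _ hg2, sq]
  have hmeas : Measurable fun p : 𝕊 × 𝕊 × 𝕊 × 𝕊 => g p.1 ^ 2 * g p.2.1 ^ 2 *
      (ENNReal.ofReal (‖(p.1 : 𝔼) + p.2.1‖ ^ 2) *
        ballInd r ((p.1 : 𝔼) + p.2.1 + p.2.2.1 + p.2.2.2)) := by
    fun_prop
  have hmeas' : Measurable fun p : 𝕊 × 𝕊 × 𝕊 × 𝕊 => g p.2.2.1 ^ 2 * g p.2.2.2 ^ 2 *
      (ENNReal.ofReal (‖(p.1 : 𝔼) + p.2.1‖ ^ 2) *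
        ballInd r ((p.1 : 𝔼) + p.2.1 + p.2.2.1 + p.2.2.2)) := by
    fun_prop
  have hmid (a b : 𝕊) : Measurable fun c : 𝕊 => ∫⁻ d, ballInd r ((a : 𝔼) + b + c + d)
      ∂sphereMeasure :=
    Measurable.lintegral_prod_right
      (by fun_prop : Measurable fun p : 𝕊 × 𝕊 => ballInd r ((a : 𝔼) + b + p.1 + p.2))
  -- Here `g` does not involve `c, d`, which are integrated first; since `‖a + b‖² ≤ 2‖a + b‖`, the
  -- factor cancels the singularity and leaves `r³`.
  have h1 : ∫⁻ a, ∫⁻ b, ∫⁻ c, ∫⁻ d, g a ^ 2 * g b ^ 2 * (ENNReal.ofReal (‖(a : 𝔼) + b‖ ^ 2) *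
      ballInd r ((a : 𝔼) + b + c + d))
      ∂sphereMeasure ∂sphereMeasure ∂sphereMeasure ∂sphereMeasure ≤
      2 * C * ENNReal.ofReal (r ^ 3) * (∫⁻ a, g a ^ 2 ∂sphereMeasure) ^ 2 := by
    rw [← hsq, ← lintegral_const_mul _ (by fun_prop)]
    refine lintegral_mono fun a => ?_
    rw [← lintegral_const_mul _ (by fun_prop)]
    refine lintegral_mono fun b => ?_
    have : ∀ c : 𝕊, ∫⁻ d, g a ^ 2 * g b ^ 2 * (ENNReal.ofReal (‖(a : 𝔼) + b‖ ^ 2) *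
        ballInd r ((a : 𝔼) + b + c + d)) ∂sphereMeasure = g a ^ 2 * g b ^ 2 *
        (ENNReal.ofReal (‖(a : 𝔼) + b‖ ^ 2) * ∫⁻ d, ballInd r ((a : 𝔼) + b + c + d)
          ∂sphereMeasure) := fun c => by
      rw [lintegral_const_mul _ (by fun_prop), lintegral_const_mul _ (by fun_prop)]
    simp_rw [this]
    rw [lintegral_const_mul _ ((hmid a b).const_mul _), lintegral_const_mul _ (hmid a b)]
    have hx := (hC ((a : 𝔼) + b) r hr hr1 (hnorm a b)).2
    have hq : ENNReal.ofReal (‖(a : 𝔼) + b‖ ^ 2) ≤ 2 * ENNReal.ofReal ‖(a : 𝔼) + b‖ := by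
      rw [ENNReal.two_mul_ofReal]
      refine ENNReal.ofReal_le_ofReal ?_
      nlinarith [hnorm a b, norm_nonneg ((a : 𝔼) + b)]
    calc _ ≤ g a ^ 2 * g b ^ 2 * (2 * ENNReal.ofReal ‖(a : 𝔼) + b‖ * _) :=
          mul_le_mul_right (mul_le_mul_left hq _) _
      _ = g a ^ 2 * g b ^ 2 * (2 * (ENNReal.ofReal ‖(a : 𝔼) + b‖ * _)) := by rw [mul_assoc 2]
      _ ≤ g a ^ 2 * g b ^ 2 * (2 * (C * ENNReal.ofReal (r ^ 3))) :=
          mul_le_mul_right (mul_le_mul_right hx _) _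
      _ = _ := by ring
  have h2 : ∫⁻ a, ∫⁻ b, ∫⁻ c, ∫⁻ d, g c ^ 2 * g d ^ 2 * (ENNReal.ofReal (‖(a : 𝔼) + b‖ ^ 2) *
      ballInd r ((a : 𝔼) + b + c + d))
      ∂sphereMeasure ∂sphereMeasure ∂sphereMeasure ∂sphereMeasure ≤
      4 * C * ENNReal.ofReal (r ^ 3) * (∫⁻ a, g a ^ 2 ∂sphereMeasure) ^ 2 := by
    rw [lintegral_four_swap_pairs hmeas', ← hsq, ← lintegral_const_mul _ (by fun_prop)]
    refine lintegral_mono fun a => ?_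
    rw [← lintegral_const_mul _ (by fun_prop)]
    refine lintegral_mono fun b => ?_
    obtain ⟨hx2, hx3⟩ := hC ((a : 𝔼) + b) r hr hr1 (hnorm a b)
    -- After exchanging the pairs the factor sits on the wrong one, but on the support `c + d` is
    -- within `r` of `-(a + b)`. The extra `r` is paid for by the nonsingular `O(r²)` bound.
    have hpt (c d : 𝕊) : ENNReal.ofReal (‖(c : 𝔼) + d‖ ^ 2) * ballInd r ((c : 𝔼) + d + a + b) ≤
        2 * (ENNReal.ofReal ‖(a : 𝔼) + b‖ + ENNReal.ofReal r) *
          ballInd r ((a : 𝔼) + b + c + d) := by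
      classical
      rw [show (c : 𝔼) + d + a + b = a + b + c + d by abel, ballInd_apply]
      split_ifs with h
      · rw [mul_one, mul_one, ← ENNReal.ofReal_add (norm_nonneg _) hr.le, ENNReal.two_mul_ofReal]
        refine ENNReal.ofReal_le_ofReal ?_
        have h' : ‖(c : 𝔼) + d‖ ≤ ‖(a : 𝔼) + b‖ + r := by
          have := norm_sub_le ((a : 𝔼) + b + c + d) ((a : 𝔼) + b)
          rw [show (a : 𝔼) + b + c + d - (a + b) = c + d by abel] at this
          linarith
        nlinarith [hnorm c d, norm_nonneg ((c : 𝔼) + d)]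
      · simp
    calc _ ≤ ∫⁻ c, ∫⁻ d, g a ^ 2 * g b ^ 2 * (2 * (ENNReal.ofReal ‖(a : 𝔼) + b‖ +
          ENNReal.ofReal r) * ballInd r ((a : 𝔼) + b + c + d)) ∂sphereMeasure ∂sphereMeasure :=
          lintegral_mono fun c => lintegral_mono fun d => mul_le_mul_right (hpt c d) _
      _ = g a ^ 2 * g b ^ 2 * (2 * (ENNReal.ofReal ‖(a : 𝔼) + b‖ +
          ENNReal.ofReal r) * ∫⁻ c, ∫⁻ d, ballInd r ((a : 𝔼) + b + c + d)
            ∂sphereMeasure ∂sphereMeasure) := by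
          have : ∀ c : 𝕊, ∫⁻ d, g a ^ 2 * g b ^ 2 * (2 * (ENNReal.ofReal ‖(a : 𝔼) + b‖ +
              ENNReal.ofReal r) * ballInd r ((a : 𝔼) + b + c + d)) ∂sphereMeasure =
              g a ^ 2 * g b ^ 2 * (2 * (ENNReal.ofReal ‖(a : 𝔼) + b‖ +
              ENNReal.ofReal r) * ∫⁻ d, ballInd r ((a : 𝔼) + b + c + d) ∂sphereMeasure) := fun c => by
            rw [lintegral_const_mul _ (by fun_prop), lintegral_const_mul _ (by fun_prop)]
          simp_rw [this]
          rw [lintegral_const_mul _ ((hmid a b).const_mul _), lintegral_const_mul _ (hmid a b)]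
      _ = g a ^ 2 * g b ^ 2 * (2 * (ENNReal.ofReal ‖(a : 𝔼) + b‖ *
            ∫⁻ c, ∫⁻ d, ballInd r ((a : 𝔼) + b + c + d) ∂sphereMeasure ∂sphereMeasure +
            ENNReal.ofReal r * ∫⁻ c, ∫⁻ d, ballInd r ((a : 𝔼) + b + c + d)
              ∂sphereMeasure ∂sphereMeasure)) := by ring
      _ ≤ g a ^ 2 * g b ^ 2 * (2 * (C * ENNReal.ofReal (r ^ 3) +
            ENNReal.ofReal r * (C * ENNReal.ofReal (r ^ 2)))) :=
          mul_le_mul_right (mul_le_mul_right (add_le_add hx3 (mul_le_mul_right hx2 _)) _) _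
      _ = g a ^ 2 * g b ^ 2 * (2 * (C * ENNReal.ofReal (r ^ 3) + C * ENNReal.ofReal (r ^ 3))) := by
          congr 3
          rw [show r ^ 3 = r * r ^ 2 by ring, ENNReal.ofReal_mul hr.le]
          ring
      _ = _ := by ring
  have h3 := calc
    8 * ∫⁻ a, ∫⁻ b, ∫⁻ c, ∫⁻ d, quadWeight g r a b c d
      ∂sphereMeasure ∂sphereMeasure ∂sphereMeasure ∂sphereMeasure
    _ ≤ _ := eight_mul_lintegral_quadWeight_le hg r
    _ ≤ 6 * ∫⁻ a, ∫⁻ b, ∫⁻ c, ∫⁻ d,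
        g a ^ 2 * g b ^ 2 * (ENNReal.ofReal (‖(a : 𝔼) + b‖ ^ 2) *
          ballInd r ((a : 𝔼) + b + c + d)) +
        g c ^ 2 * g d ^ 2 * (ENNReal.ofReal (‖(a : 𝔼) + b‖ ^ 2) *
          ballInd r ((a : 𝔼) + b + c + d))
        ∂sphereMeasure ∂sphereMeasure ∂sphereMeasure ∂sphereMeasure := by
        -- The elementary inequality `XY ≤ X² + Y²` with `X = g(a) g(b)` and `Y = g(c) g(d)`
        -- separates the two pairs.
        refine mul_le_mul_right (lintegral_mono fun a => lintegral_mono fun b =>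
          lintegral_mono fun c => lintegral_mono fun d => ?_) _
        rw [quadWeight, ← add_mul, mul_left_comm]
        refine mul_le_mul_left ?_ _
        rw [← mul_pow, ← mul_pow]
        rcases le_total (g a * g b) (g c * g d) with h | h
        · exact le_add_left (by rw [sq]; gcongr)
        · exact le_add_right (by rw [sq]; gcongr)
    _ ≤ 6 * (2 * C * ENNReal.ofReal (r ^ 3) * (∫⁻ a, g a ^ 2 ∂sphereMeasure) ^ 2 +
        4 * C * ENNReal.ofReal (r ^ 3) * (∫⁻ a, g a ^ 2 ∂sphereMeasure) ^ 2) := by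
        rw [lintegral_four_add_left hmeas]
        exact mul_le_mul_right (add_le_add h1 h2) _
    _ ≤ 8 * (6 * C * ENNReal.ofReal (r ^ 3) * (∫⁻ a, g a ^ 2 ∂sphereMeasure) ^ 2) := by
        set Y := (C : ℝ≥0∞) * ENNReal.ofReal (r ^ 3) * (∫⁻ a, g a ^ 2 ∂sphereMeasure) ^ 2
        calc _ = 36 * Y := by ring
          _ ≤ 48 * Y := by gcongr; norm_num
          _ = _ := by ring
  rw [ENNReal.mul_le_mul_iff_right (by norm_num) (by norm_num)] at h3
  exact h3.trans (by push_cast; exact le_rfl)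

open Set Metric Pointwise in
theorem measurePreserving_neg_sphereMeasure :
    MeasurePreserving (Neg.neg : 𝕊 → 𝕊) sphereMeasure sphereMeasure := by
  refine ⟨measurable_neg, ?_⟩
  ext A hA
  rw [Measure.map_apply measurable_neg hA, sphereMeasure,
    Measure.toSphere_apply' _ (measurable_neg hA), Measure.toSphere_apply' _ hA]
  congr 1
  rw [← Measure.measure_neg]
  congr 1
  ext y
  simp only [Set.mem_neg, Set.mem_smul, Set.mem_image]
  constructor
  · rintro ⟨s, hs, _, ⟨ω, hω, rfl⟩, h⟩
    exact ⟨s, hs, _, ⟨-ω, hω, rfl⟩, by rw [coe_neg_sphere, smul_neg, h, neg_neg]⟩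
  · rintro ⟨s, hs, _, ⟨ω, hω, rfl⟩, h⟩
    exact ⟨s, hs, _, ⟨-ω, by simpa using hω, rfl⟩, by rw [coe_neg_sphere, smul_neg, h]⟩

/-- Version of `exists_lintegral_quadWeight_le` for quadruples with `a + b` close to `c + d`. -/
theorem exists_lintegral_four_sphere_le : ∃ C : ℝ≥0, ∀ (g : 𝕊 → ℝ≥0∞), Measurable g →
    ∀ r : ℝ, 0 < r → r ≤ 1 / 2 →
    ∫⁻ p, ∫⁻ q, g p.1 * g p.2 * (g q.1 * g q.2) * ballInd r ((p.1 : 𝔼) + p.2 - (q.1 + q.2))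
      ∂(sphereMeasure.prod sphereMeasure) ∂(sphereMeasure.prod sphereMeasure) ≤
    C * ENNReal.ofReal (r ^ 3) * (∫⁻ a, g a ^ 2 ∂sphereMeasure) ^ 2 := by
  obtain ⟨C, hC⟩ := exists_lintegral_quadWeight_le
  refine ⟨C * 16, fun g hg r hr hr1 => ?_⟩
  -- Symmetrising lets `c, d` be replaced by their antipodes, turning a difference of pair sums into
  -- a fourfold sum. It multiplies `∫ g²` by at most 4, hence the factor `16 = 4²`.
  set g' : 𝕊 → ℝ≥0∞ := fun a => g a + g (-a) with hg'
  have hg'm : Measurable g' := by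
    have : Measurable fun a => g (-a) := hg.comp measurable_neg
    fun_prop
  have hneg (f : 𝕊 → ℝ≥0∞) : ∫⁻ a, f (-a) ∂sphereMeasure = ∫⁻ a, f a ∂sphereMeasure :=
    measurePreserving_neg_sphereMeasure.lintegral_comp_emb
      (Homeomorph.neg 𝕊).measurableEmbedding f
  have hsq : ∫⁻ a, g' a ^ 2 ∂sphereMeasure ≤ 4 * ∫⁻ a, g a ^ 2 ∂sphereMeasure := by
    calc _ ≤ ∫⁻ a, 2 * g a ^ 2 + 2 * g (-a) ^ 2 ∂sphereMeasure := by
          refine lintegral_mono fun a => ?_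
          have := ENNReal.rpow_add_le_mul_rpow_add_rpow (g a) (g (-a)) (p := 2) one_le_two
          norm_num at this
          rwa [mul_add] at this
      _ = _ := by
          rw [lintegral_add_left (by fun_prop), hneg fun a => 2 * g a ^ 2,
            lintegral_const_mul _ (by fun_prop)]
          ring
  have hint (a b : 𝕊) : ∫⁻ q, g a * g b * (g q.1 * g q.2) *
      ballInd r ((a : 𝔼) + b - (q.1 + q.2)) ∂(sphereMeasure.prod sphereMeasure) ≤
      ∫⁻ c, ∫⁻ d, quadWeight g' r a b c d ∂sphereMeasure ∂sphereMeasure := by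
    rw [lintegral_prod _ (by fun_prop)]
    rw [← hneg]
    refine lintegral_mono fun c => ?_
    rw [← hneg]
    refine lintegral_mono fun d => ?_
    simp only [quadWeight, hg', coe_neg_sphere]
    rw [show (a : 𝔼) + b - (-c + -d) = a + b + c + d by abel]
    gcongr
    · exact le_self_add
    · exact le_self_add
    · exact le_add_self
    · exact le_add_self
  calc _ ≤ ∫⁻ p, ∫⁻ c, ∫⁻ d, quadWeight g' r p.1 p.2 c d ∂sphereMeasure ∂sphereMeasure
        ∂(sphereMeasure.prod sphereMeasure) := lintegral_mono fun p => hint p.1 p.2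
    _ = ∫⁻ a, ∫⁻ b, ∫⁻ c, ∫⁻ d, quadWeight g' r a b c d
      ∂sphereMeasure ∂sphereMeasure ∂sphereMeasure ∂sphereMeasure := by
        refine lintegral_prod _ (Measurable.aemeasurable ?_)
        refine Measurable.lintegral_prod_right' (f := fun q : (𝕊 × 𝕊) × 𝕊 =>
          ∫⁻ d, quadWeight g' r q.1.1 q.1.2 q.2 d ∂sphereMeasure) ?_
        exact Measurable.lintegral_prod_right' (f := fun q : ((𝕊 × 𝕊) × 𝕊) × 𝕊 =>
          quadWeight g' r q.1.1.1 q.1.1.2 q.1.2 q.2) (by fun_prop)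
    _ ≤ _ := hC g' hg'm r hr hr1
    _ ≤ C * ENNReal.ofReal (r ^ 3) * (4 * ∫⁻ a, g a ^ 2 ∂sphereMeasure) ^ 2 := by gcongr
    _ = _ := by push_cast; ring

/-! ### From small-scale energy to an `L²` functional -/

theorem ENNReal.lintegral_mul_sq_le {X : Type*} [MeasurableSpace X] {ν : Measure X}
    {f g : X → ℝ≥0∞} (hf : AEMeasurable f ν) (hg : AEMeasurable g ν) :
    (∫⁻ x, f x * g x ∂ν) ^ 2 ≤ (∫⁻ x, f x ^ 2 ∂ν) * ∫⁻ x, g x ^ 2 ∂ν := by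
  have h := ENNReal.lintegral_mul_le_Lp_mul_Lq ν (p := 2) (q := 2)
    (by constructor <;> norm_num) hf hg
  calc _ ≤ _ := pow_le_pow_left' h 2
    _ = _ := by
      simp only [mul_pow]
      rw [← ENNReal.rpow_natCast, ← ENNReal.rpow_natCast, ← ENNReal.rpow_mul, ← ENNReal.rpow_mul]
      norm_num

theorem lintegral_ballInd_sub (r : ℝ) (x : 𝔼) :
    ∫⁻ y, ballInd r (x - y) = volume (Metric.closedBall (0 : 𝔼) r) := by
  rw [lintegral_sub_left_eq_self (ballInd r) x, ballInd,
    lintegral_indicator_one measurableSet_closedBall]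

/-- Near `z` the function exceeds any level below `H z`. Unlike Lebesgue differentiation this holds
at every point, which matters because the push-forward measures tested later are not known to be
absolutely continuous. -/
theorem LowerSemicontinuous.le_liminf_average {H : 𝔼 → ℝ≥0∞} (hH : LowerSemicontinuous H)
    {r : ℕ → ℝ} (hr : Filter.Tendsto r .atTop (nhds 0)) (hr0 : ∀ n, 0 < r n) (z : 𝔼) :
    H z ≤ Filter.liminf (fun n => (volume (Metric.closedBall (0 : 𝔼) (r n)))⁻¹ *
      ∫⁻ x, H x * ballInd (r n) (z - x)) .atTop := by
  refine le_of_forall_lt fun a ha => ?_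
  obtain ⟨b, hab, hb⟩ := exists_between ha
  refine hab.trans_le ?_
  obtain ⟨δ, hδ, hball⟩ := Metric.eventually_nhds_iff.1 (hH z b hb)
  refine Filter.le_liminf_of_le (by isBoundedDefault) ?_
  filter_upwards [hr.eventually (gt_mem_nhds hδ)] with n hn
  have hpos : volume (Metric.closedBall (0 : 𝔼) (r n)) ≠ 0 :=
    (Metric.measure_closedBall_pos _ _ (hr0 n)).ne'
  have hfin : volume (Metric.closedBall (0 : 𝔼) (r n)) ≠ ⊤ := measure_closedBall_lt_top.ne
  calc b = (volume (Metric.closedBall (0 : 𝔼) (r n)))⁻¹ * ∫⁻ x, b * ballInd (r n) (z - x) := by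
        rw [lintegral_const_mul _ (by fun_prop), lintegral_ballInd_sub, mul_comm, mul_assoc,
          ENNReal.mul_inv_cancel hpos hfin, mul_one]
    _ ≤ _ := by
        refine mul_le_mul_right (lintegral_mono fun x => ?_) _
        classical
        simp only [ballInd_apply]
        split_ifs with h
        · gcongr
          refine (hball ?_).le
          rw [dist_comm, dist_eq_norm]
          linarith
        · simp

/-- If the "additive energy" of a weight at scale `r` is `O(r³)`, then the weight defines a bounded
functional on nonnegative lower semicontinuous functions in `L²`. -/
theorem lintegral_comp_sq_le_of_energy_le {P : Type*} [MeasurableSpace P] {ρ : Measure P} [SFinite ρ]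
    {s : P → 𝔼} (hs : Measurable s) {G : P → ℝ≥0∞} (hG : Measurable G) {M : ℝ≥0∞}
    (hM : ∀ r : ℝ, 0 < r → r ≤ 1 / 2 →
      ∫⁻ p, ∫⁻ q, G p * G q * ballInd r (s p - s q) ∂ρ ∂ρ ≤ M * ENNReal.ofReal (r ^ 3))
    {H : 𝔼 → ℝ≥0∞} (hH : LowerSemicontinuous H) :
    (∫⁻ p, G p * H (s p) ∂ρ) ^ 2 ≤
      8 * (volume (Metric.closedBall (0 : 𝔼) 1))⁻¹ * M * ∫⁻ x, H x ^ 2 := by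
  set V := volume (Metric.closedBall (0 : 𝔼) 1) with hV
  have hV0 : V ≠ 0 := (Metric.measure_closedBall_pos _ _ one_pos).ne'
  have hVt : V ≠ ⊤ := measure_closedBall_lt_top.ne
  have hVr {r : ℝ} (hr : 0 < r) : volume (Metric.closedBall (0 : 𝔼) r) =
      ENNReal.ofReal (r ^ 3) * V := by
    rw [Measure.addHaar_closedBall' _ _ hr.le]; simp [V]
  have hHm := hH.measurable
  have hbound {r : ℝ} (hr : 0 < r) (hr1 : r ≤ 1 / 4) :
      (∫⁻ p, G p * ((volume (Metric.closedBall (0 : 𝔼) r))⁻¹ *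
        ∫⁻ x, H x * ballInd r (s p - x)) ∂ρ) ^ 2 ≤ 8 * V⁻¹ * M * ∫⁻ x, H x ^ 2 := by
    -- `N` is the push-forward of `G dρ` smeared at scale `r`. Two points within `r` of a common `x`
    -- are within `2r` of each other, so `∫ N²` is controlled by the energy at scale `2r`; hence the
    -- restriction `r ≤ 1/4`.
    set N : 𝔼 → ℝ≥0∞ := fun x => ∫⁻ p, G p * ballInd r (s p - x) ∂ρ with hN
    have hNm : Measurable N := Measurable.lintegral_prod_right' (f := fun q : 𝔼 × P =>
      G q.2 * ballInd r (s q.2 - q.1)) (by fun_prop)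
    set k : P → ℝ≥0∞ := fun p => ∫⁻ q, G p * G q * ballInd (2 * r) (s p - s q) ∂ρ with hk
    have hkm : Measurable k := Measurable.lintegral_prod_right' (f := fun q : P × P =>
      G q.1 * G q.2 * ballInd (2 * r) (s q.1 - s q.2)) (by fun_prop)
    have hball (x y z : 𝔼) : ballInd r (y - x) * ballInd r (z - x) ≤
        ballInd r (y - x) * ballInd (2 * r) (y - z) := by
      classical
      simp only [ballInd_apply]
      by_cases h1 : ‖y - x‖ ≤ r <;> by_cases h2 : ‖z - x‖ ≤ r <;> simp only [h1, h2, if_true,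
        if_false, mul_zero, zero_mul, mul_one, one_mul, le_refl, zero_le]
      rw [if_pos]
      calc ‖y - z‖ = ‖(y - x) - (z - x)‖ := by congr 1; abel
        _ ≤ _ := (norm_sub_le _ _).trans (by linarith)
    have hN2 : ∫⁻ x, N x ^ 2 ≤ ENNReal.ofReal (r ^ 3) * V * (M * ENNReal.ofReal ((2 * r) ^ 3)) :=
      calc _ ≤ ∫⁻ x, ∫⁻ p, k p * ballInd r (s p - x) ∂ρ := by
            refine lintegral_mono fun x => ?_
            simp only [sq]
            nth_rewrite 1 [hN]
            rw [← lintegral_mul_const _ (by fun_prop)]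
            refine lintegral_mono fun p => ?_
            simp only [hN, hk]
            rw [← lintegral_const_mul _ (by fun_prop), ← lintegral_mul_const _ (by fun_prop)]
            refine lintegral_mono fun q => ?_
            calc _ = G p * G q * (ballInd r (s p - x) * ballInd r (s q - x)) := by ring
              _ ≤ G p * G q * _ := mul_le_mul_right (hball x (s p) (s q)) _
              _ = _ := by ring
        _ = ∫⁻ p, ∫⁻ x, k p * ballInd r (s p - x) ∂volume ∂ρ :=
            lintegral_lintegral_swap (by fun_prop)
        _ = ∫⁻ p, k p * volume (Metric.closedBall (0 : 𝔼) r) ∂ρ := by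
            refine lintegral_congr fun p => ?_
            rw [lintegral_const_mul _ (by fun_prop), lintegral_ballInd_sub]
        _ = ENNReal.ofReal (r ^ 3) * V * ∫⁻ p, k p ∂ρ := by
            rw [lintegral_mul_const _ hkm, hVr hr, mul_comm]
        _ ≤ _ := mul_le_mul_right (hM (2 * r) (by positivity) (by linarith)) _
    have hswap : ∫⁻ p, G p * ((volume (Metric.closedBall (0 : 𝔼) r))⁻¹ *
        ∫⁻ x, H x * ballInd r (s p - x)) ∂ρ =
        (volume (Metric.closedBall (0 : 𝔼) r))⁻¹ * ∫⁻ x, H x * N x := by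
      calc _ = ∫⁻ p, ∫⁻ x, (volume (Metric.closedBall (0 : 𝔼) r))⁻¹ *
            (H x * (G p * ballInd r (s p - x))) ∂volume ∂ρ := by
            refine lintegral_congr fun p => ?_
            rw [← lintegral_const_mul _ (by fun_prop), ← lintegral_const_mul _ (by fun_prop)]
            refine lintegral_congr fun x => ?_
            ring
        _ = ∫⁻ x, ∫⁻ p, (volume (Metric.closedBall (0 : 𝔼) r))⁻¹ *
            (H x * (G p * ballInd r (s p - x))) ∂ρ := lintegral_lintegral_swap (by fun_prop)
        _ = _ := by
            rw [← lintegral_const_mul _ (by fun_prop)]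
            refine lintegral_congr fun x => ?_
            rw [lintegral_const_mul _ (by fun_prop), lintegral_const_mul _ (by fun_prop)]
    rw [hswap, mul_pow, hVr hr]
    -- All powers of `r` cancel: two factors `r³` from `∫ N²` against the squared normalisation,
    -- leaving `(2r)³ / r³ = 8`.
    calc _ ≤ ((ENNReal.ofReal (r ^ 3) * V)⁻¹) ^ 2 * ((∫⁻ x, H x ^ 2) *
          (ENNReal.ofReal (r ^ 3) * V * (M * ENNReal.ofReal ((2 * r) ^ 3)))) := by
          refine mul_le_mul_right ((ENNReal.lintegral_mul_sq_le hHm.aemeasurable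
            hNm.aemeasurable).trans (mul_le_mul_right hN2 _)) _
      _ = _ := by
          have h8 : ENNReal.ofReal ((2 * r) ^ 3) = 8 * ENNReal.ofReal (r ^ 3) := by
            rw [mul_pow, ENNReal.ofReal_mul (by norm_num)]; norm_num
          set R := ENNReal.ofReal (r ^ 3)
          have hR0 : R ≠ 0 := by simp only [R, ne_eq, ENNReal.ofReal_eq_zero, not_le]; positivity
          have hRt : R ≠ ⊤ := ENNReal.ofReal_ne_top
          rw [h8, ENNReal.mul_inv (Or.inl hR0) (Or.inl hRt)]
          calc _ = (R⁻¹ * R) ^ 2 * (V⁻¹ * V) * (8 * V⁻¹ * M * ∫⁻ x, H x ^ 2) := by ring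
            _ = _ := by
              rw [ENNReal.inv_mul_cancel hR0 hRt, ENNReal.inv_mul_cancel hV0 hVt, one_pow, one_mul,
                one_mul]
  set r : ℕ → ℝ := fun n => 1 / 4 / (n + 1) with hr
  have hr0 (n) : 0 < r n := by positivity
  have hr1 (n) : r n ≤ 1 / 4 := by
    simp only [hr]; rw [div_le_iff₀ (by positivity)]; nlinarith [(Nat.cast_nonneg n : (0 : ℝ) ≤ n)]
  have hrt : Filter.Tendsto r .atTop (nhds 0) := by
    have h := (tendsto_one_div_add_atTop_nhds_zero_nat (𝕜 := ℝ)).const_mul (1 / 4)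
    rw [mul_zero] at h
    exact h.congr fun n => by simp only [hr]; ring
  set Y := 8 * V⁻¹ * M * ∫⁻ x, H x ^ 2 with hY
  -- Fatou's lemma transfers the scale-uniform bound to `H` itself.
  have hfinal : ∫⁻ p, G p * H (s p) ∂ρ ≤ Y ^ (1 / 2 : ℝ) := by
    calc _ ≤ ∫⁻ p, Filter.liminf (fun n => G p * ((volume (Metric.closedBall (0 : 𝔼) (r n)))⁻¹ *
            ∫⁻ x, H x * ballInd (r n) (s p - x))) .atTop ∂ρ := by
          refine lintegral_mono fun p => ?_
          refine (mul_le_mul_right (hH.le_liminf_average hrt hr0 (s p)) _).trans ?_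
          simp only [Filter.liminf_eq_iSup_iInf_of_nat, ENNReal.mul_iSup]
          exact iSup_mono fun n => le_iInf₂ fun i hi => mul_le_mul_right (iInf₂_le i hi) _
      _ ≤ Filter.liminf (fun n => ∫⁻ p, G p * ((volume (Metric.closedBall (0 : 𝔼) (r n)))⁻¹ *
            ∫⁻ x, H x * ballInd (r n) (s p - x)) ∂ρ) .atTop := by
          refine lintegral_liminf_le fun n => ?_
          refine hG.mul (Measurable.const_mul ?_ _)
          exact Measurable.lintegral_prod_right' (f := fun q : P × 𝔼 =>
            H q.2 * ballInd (r n) (s q.1 - q.2)) (by fun_prop)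
      _ ≤ Y ^ (1 / 2 : ℝ) := by
          refine Filter.liminf_le_of_le (by isBoundedDefault) fun b hb => ?_
          obtain ⟨n, hn⟩ := hb.exists
          refine hn.trans ?_
          rw [one_div, ENNReal.le_rpow_inv_iff (by norm_num)]
          exact_mod_cast hbound (hr0 n) (hr1 n)
  rw [one_div, ENNReal.le_rpow_inv_iff (by norm_num)] at hfinal
  exact_mod_cast hfinal

/-- The endpoint Stein–Tomas estimate for the sphere in `ℝ³`, in bilinear dual form. -/
theorem exists_lintegral_sphere_bilinear_sq_le : ∃ C : ℝ≥0, ∀ (g : 𝕊 → ℝ≥0∞), Measurable g →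
    ∀ H : 𝔼 → ℝ≥0∞, LowerSemicontinuous H →
    (∫⁻ p, g p.1 * g p.2 * H ((p.1 : 𝔼) + p.2) ∂(sphereMeasure.prod sphereMeasure)) ^ 2 ≤
      C * (∫⁻ a, g a ^ 2 ∂sphereMeasure) ^ 2 * ∫⁻ x, H x ^ 2 := by
  obtain ⟨C, hC⟩ := exists_lintegral_four_sphere_le
  have hVinv : (volume (Metric.closedBall (0 : 𝔼) 1))⁻¹ ≠ ⊤ :=
    ENNReal.inv_ne_top.2 (Metric.measure_closedBall_pos _ _ one_pos).ne'
  refine ⟨8 * (volume (Metric.closedBall (0 : 𝔼) 1))⁻¹.toNNReal * C, fun g hg H hH => ?_⟩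
  refine (lintegral_comp_sq_le_of_energy_le (s := fun p : 𝕊 × 𝕊 => (p.1 : 𝔼) + p.2) (by fun_prop)
    (G := fun p => g p.1 * g p.2) (by fun_prop)
    (M := C * (∫⁻ a, g a ^ 2 ∂sphereMeasure) ^ 2) (fun r hr hr1 => ?_) hH).trans (le_of_eq ?_)
  · exact (hC g hg r hr hr1).trans (le_of_eq (by ring))
  · push_cast
    rw [ENNReal.coe_toNNReal hVinv]
    ring

/-! ### Lower semicontinuity and the maximal function -/

/-- Fatou's lemma along a sequence; first countability is what supplies a sequence witnessing a
failure. -/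
theorem LowerSemicontinuous.lintegral_param {X Y : Type*} [TopologicalSpace X]
    [FirstCountableTopology X] [MeasurableSpace Y] {ν : Measure Y} {F : X → Y → ℝ≥0∞}
    (hF : ∀ y, LowerSemicontinuous fun x => F x y) (hm : ∀ x, Measurable (F x)) :
    LowerSemicontinuous fun x => ∫⁻ y, F x y ∂ν := by
  intro x c hc
  by_contra h
  rw [Filter.not_eventually] at h
  obtain ⟨u, hu, huc⟩ := Filter.exists_seq_forall_of_frequently h
  refine hc.not_ge ?_
  calc ∫⁻ y, F x y ∂ν ≤ ∫⁻ y, Filter.liminf (fun n => F (u n) y) .atTop ∂ν := by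
        refine lintegral_mono fun y => ?_
        refine le_of_forall_lt fun a ha => ?_
        obtain ⟨b, hab, hb⟩ := exists_between ha
        refine hab.trans_le (Filter.le_liminf_of_le (by isBoundedDefault) ?_)
        exact (hu.eventually (hF y x b hb)).mono fun n hn => le_of_lt hn
    _ ≤ Filter.liminf (fun n => ∫⁻ y, F (u n) y ∂ν) .atTop := lintegral_liminf_le fun n => hm _
    _ ≤ c := by
        refine Filter.liminf_le_of_le (by isBoundedDefault) fun b hb => ?_
        obtain ⟨n, hn⟩ := hb.exists
        exact hn.trans (not_lt.1 (huc n))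

theorem lintegral_dilate (μ : Measure 𝔼) {h : 𝔼 → ℂ} (hh : Measurable h) {t : ℝ}
    (x : 𝔼) : ∫⁻ y, ‖h (x - y)‖ₑ ∂(dilate μ t) = ∫⁻ y, ‖h (x - t • y)‖ₑ ∂μ := by
  rw [dilate, lintegral_map (by fun_prop) (by fun_prop)]

theorem lintegral_le_maximalFn (μ : Measure 𝔼) {h : 𝔼 → ℂ} (hh : Measurable h) {t : ℝ}
    (ht : 0 < t) (x : 𝔼) : ∫⁻ y, ‖h (x - t • y)‖ₑ ∂μ ≤ maximalFn μ h x := by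
  rw [← lintegral_dilate μ hh]
  exact le_iSup₂ (f := fun (t : ℝ) (_ : 0 < t) => ∫⁻ y, ‖h (x - y)‖ₑ ∂(dilate μ t)) t ht

theorem lowerSemicontinuous_maximalFn (μ : Measure 𝔼) {h : 𝔼 → ℂ} (hh : Measurable h)
    (hl : LowerSemicontinuous fun x => ‖h x‖ₑ) : LowerSemicontinuous (maximalFn μ h) := by
  refine lowerSemicontinuous_biSup fun t ht => LowerSemicontinuous.lintegral_param
    (fun y => ?_) (fun x => by fun_prop)
  exact hl.comp (by fun_prop : Continuous fun x : 𝔼 => x - y)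

theorem maximalFn_le_of_bound (μ : Measure 𝔼) {h : 𝔼 → ℂ} {K : ℝ≥0∞} (hK : ∀ x, ‖h x‖ₑ ≤ K)
    (x : 𝔼) : maximalFn μ h x ≤ K * μ Set.univ := by
  refine iSup₂_le fun t ht => ?_
  calc _ ≤ ∫⁻ y, K ∂(dilate μ t) := lintegral_mono fun y => hK _
    _ = _ := by rw [lintegral_const, dilate, Measure.map_apply (by fun_prop) .univ, Set.preimage_univ]

theorem eLpNorm_two_sq {X F : Type*} [MeasurableSpace X] [TopologicalSpace F] [ContinuousENorm F]
    (ν : Measure X) (f : X → F) : eLpNorm f 2 ν ^ 2 = ∫⁻ x, ‖f x‖ₑ ^ 2 ∂ν := by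
  have := eLpNorm_nnreal_pow_eq_lintegral (μ := ν) (f := f) (p := 2) (by norm_num)
  norm_num at this
  exact_mod_cast this

/-- A bounded lower semicontinuous function in `L²` has all its averages over dilates of `μ` dominated
by a bounded lower semicontinuous function with controlled `L²` norm, namely its maximal function. -/
theorem exists_dominating_of_maximalBoundedL2 {μ : Measure 𝔼} [IsFiniteMeasure μ] {A : ℝ≥0}
    (hA : ∀ g : 𝔼 → ℂ, MemLp g 2 volume → eLpNorm (maximalFn μ g) 2 volume ≤ A * eLpNorm g 2 volume)
    {W : 𝔼 → ℝ≥0∞} (hW : LowerSemicontinuous W) {K : ℝ≥0} (hK : ∀ x, W x ≤ K)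
    (hW2 : ∫⁻ x, W x ^ 2 ≠ ⊤) :
    ∃ W' : 𝔼 → ℝ≥0∞, LowerSemicontinuous W' ∧ (∃ K' : ℝ≥0, ∀ x, W' x ≤ K') ∧
      ∫⁻ x, W' x ^ 2 ≤ A ^ 2 * ∫⁻ x, W x ^ 2 ∧
      ∀ (t : ℝ), 0 < t → ∀ x, ∫⁻ y, W (x - t • y) ∂μ ≤ W' x := by
  -- The bound on `W` makes `toReal` lossless; it is propagated to `W'` so that the construction can
  -- be iterated.
  set h : 𝔼 → ℂ := fun x => ((W x).toReal : ℂ) with hh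
  have hWm := hW.measurable
  have hhm : Measurable h := by fun_prop
  have hhW (x : 𝔼) : ‖h x‖ₑ = W x := by
    simp only [hh]
    rw [← ofReal_norm, Complex.norm_real, Real.norm_of_nonneg ENNReal.toReal_nonneg,
      ENNReal.ofReal_toReal (ne_top_of_le_ne_top ENNReal.coe_ne_top (hK x))]
  have hsq : eLpNorm h 2 volume ^ 2 = ∫⁻ x, W x ^ 2 := by
    rw [eLpNorm_two_sq]; simp only [hhW]
  have hmem : MemLp h 2 volume := by
    refine ⟨hhm.aestronglyMeasurable, ?_⟩
    rw [lt_top_iff_ne_top]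
    intro htop
    rw [htop] at hsq
    exact hW2 (by rw [← hsq]; simp)
  refine ⟨maximalFn μ h, lowerSemicontinuous_maximalFn μ hhm (by simpa only [hhW] using hW),
    ⟨(K * μ Set.univ).toNNReal, fun x => ?_⟩, ?_, fun t ht x => ?_⟩
  · rw [ENNReal.coe_toNNReal (ENNReal.mul_ne_top ENNReal.coe_ne_top (measure_ne_top _ _))]
    exact maximalFn_le_of_bound μ (fun x => (hhW x).trans_le (hK x)) x
  · have h1 := pow_le_pow_left' (hA h hmem) 2
    rw [mul_pow, eLpNorm_two_sq, hsq] at h1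
    simpa using h1
  · simpa only [hhW] using lintegral_le_maximalFn μ hhm ht x

/-! ### The linearised adjoint measure -/

/-- The superposition, with weight `g(ω) dω`, of the images of `μ` under `y ↦ ω - τ(ω) y`. -/
noncomputable def spreadMeasure (μ : Measure 𝔼) (g : 𝕊 → ℝ≥0∞) (τ : 𝕊 → ℝ) : Measure 𝔼 :=
  ((sphereMeasure.withDensity g).prod μ).map fun p => (p.1 : 𝔼) - τ p.1 • p.2

theorem lintegral_spreadMeasure {μ : Measure 𝔼} [IsFiniteMeasure μ] {g : 𝕊 → ℝ≥0∞}
    (hg : Measurable g) {τ : 𝕊 → ℝ} (hτ : Measurable τ) {f : 𝔼 → ℝ≥0∞} (hf : Measurable f) :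
    ∫⁻ z, f z ∂(spreadMeasure μ g τ) =
      ∫⁻ ω, g ω * ∫⁻ y, f (ω - τ ω • y) ∂μ ∂sphereMeasure := by
  have h1 : Measurable fun p : 𝕊 × 𝔼 => f ((p.1 : 𝔼) - τ p.1 • p.2) := by fun_prop
  rw [spreadMeasure, lintegral_map hf (by fun_prop), lintegral_prod _ h1.aemeasurable,
    lintegral_withDensity_eq_lintegral_mul _ hg h1.lintegral_prod_right']
  rfl

/-- In `W(z + z')` each variable carries one displacement `τ(ω) y`. Averaging over the one in `z'`
gives at most `W₁`, and then over the one in `z` at most `W₂`, successive maximal functions that do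
not see `τ`. The sphere estimate applied to `W₂` therefore yields a constant uniform in `τ`. -/
theorem exists_spreadMeasure_bilinear_sq_le {μ : Measure 𝔼} [IsFiniteMeasure μ]
    (hμ : MaximalBoundedL2 μ) : ∃ C : ℝ≥0, ∀ (g : 𝕊 → ℝ≥0∞), Measurable g → ∀ (τ : 𝕊 → ℝ),
    Measurable τ → (∀ ω, 0 < τ ω) → ∀ W : 𝔼 → ℝ≥0∞, LowerSemicontinuous W →
    (∃ K : ℝ≥0, ∀ x, W x ≤ K) → ∫⁻ x, W x ^ 2 ≠ ⊤ →
    (∫⁻ z, ∫⁻ z', W (z + z') ∂(spreadMeasure μ g τ) ∂(spreadMeasure μ g τ)) ^ 2 ≤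
      C * (∫⁻ a, g a ^ 2 ∂sphereMeasure) ^ 2 * ∫⁻ x, W x ^ 2 := by
  obtain ⟨A, hA⟩ := hμ
  obtain ⟨C, hC⟩ := exists_lintegral_sphere_bilinear_sq_le
  refine ⟨C * (A ^ 2 * A ^ 2), fun g hg τ hτ hτ0 W hW ⟨K, hK⟩ hW2 => ?_⟩
  obtain ⟨W₁, hW₁, ⟨K₁, hK₁⟩, hW₁2, hle₁⟩ := exists_dominating_of_maximalBoundedL2 hA hW hK hW2
  have hW₁t : ∫⁻ x, W₁ x ^ 2 ≠ ⊤ :=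
    ne_top_of_le_ne_top (ENNReal.mul_ne_top (by simp) hW2) hW₁2
  obtain ⟨W₂, hW₂, -, hW₂2, hle₂⟩ := exists_dominating_of_maximalBoundedL2 hA hW₁ hK₁ hW₁t
  have hWm := hW.measurable
  have hW₁m := hW₁.measurable
  have hW₂m := hW₂.measurable
  have hin (z : 𝔼) : ∫⁻ z', W (z + z') ∂(spreadMeasure μ g τ) ≤
      ∫⁻ ω', g ω' * W₁ (z + ω') ∂sphereMeasure := by
    rw [lintegral_spreadMeasure hg hτ (by fun_prop)]
    refine lintegral_mono fun ω' => mul_le_mul_right ?_ _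
    simp only [← add_sub_assoc]
    exact hle₁ _ (hτ0 ω') _
  have hout (ω : 𝕊) : ∫⁻ y, ∫⁻ ω', g ω' * W₁ ((ω : 𝔼) - τ ω • y + ω') ∂sphereMeasure ∂μ ≤
      ∫⁻ ω', g ω' * W₂ ((ω : 𝔼) + ω') ∂sphereMeasure := by
    rw [lintegral_lintegral_swap (by fun_prop)]
    refine lintegral_mono fun ω' => ?_
    rw [lintegral_const_mul _ (by fun_prop)]
    simp only [sub_add_eq_add_sub]
    exact mul_le_mul_right (hle₂ _ (hτ0 ω) _) _
  have hmain : ∫⁻ z, ∫⁻ z', W (z + z') ∂(spreadMeasure μ g τ) ∂(spreadMeasure μ g τ) ≤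
      ∫⁻ p, g p.1 * g p.2 * W₂ ((p.1 : 𝔼) + p.2) ∂(sphereMeasure.prod sphereMeasure) := by
    calc _ ≤ ∫⁻ z, ∫⁻ ω', g ω' * W₁ (z + ω') ∂sphereMeasure ∂(spreadMeasure μ g τ) :=
          lintegral_mono hin
      _ = ∫⁻ ω, g ω * ∫⁻ y, ∫⁻ ω', g ω' * W₁ ((ω : 𝔼) - τ ω • y + ω') ∂sphereMeasure ∂μ
          ∂sphereMeasure := by
          refine lintegral_spreadMeasure hg hτ ?_
          exact Measurable.lintegral_prod_right' (f := fun q : 𝔼 × 𝕊 => g q.2 * W₁ (q.1 + q.2))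
            (by fun_prop)
      _ ≤ ∫⁻ ω, g ω * ∫⁻ ω', g ω' * W₂ ((ω : 𝔼) + ω') ∂sphereMeasure ∂sphereMeasure :=
          lintegral_mono fun ω => mul_le_mul_right (hout ω) _
      _ = _ := by
          rw [lintegral_prod _ (by fun_prop)]
          refine lintegral_congr fun ω => ?_
          rw [← lintegral_const_mul _ (by fun_prop)]
          simp only [mul_assoc]
  calc _ ≤ _ := pow_le_pow_left' hmain 2
    _ ≤ _ := hC g hg W₂ hW₂
    _ ≤ C * (∫⁻ a, g a ^ 2 ∂sphereMeasure) ^ 2 * (A ^ 2 * (A ^ 2 * ∫⁻ x, W x ^ 2)) :=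
        mul_le_mul_right (hW₂2.trans (mul_le_mul_right hW₁2 _)) _
    _ = _ := by push_cast; ring

/-! ### Gaussian-regularised Plancherel -/

section ExponentialIntegral

variable {Y : Type*} [MeasurableSpace Y]

/-- The exponential integral `∫ e^{-2πi⟨Z(y), ξ⟩} a(y) dm(y)`, that is the Fourier transform of the
push-forward of `a dm` under `Z`. -/
noncomputable def expIntegral (m : Measure Y) (Z : Y → 𝔼) (a : Y → ℂ) (ξ : 𝔼) : ℂ :=
  ∫ y, ((Real.fourierChar (-inner ℝ (Z y) ξ) : Circle) : ℂ) * a y ∂m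

variable {m : Measure Y} [IsFiniteMeasure m] {Z : Y → 𝔼} {a : Y → ℂ}

theorem norm_expIntegral_le (ha1 : ∀ y, ‖a y‖ ≤ 1) (ξ : 𝔼) :
    ‖expIntegral m Z a ξ‖ ≤ m.real Set.univ := by
  refine (norm_integral_le_of_norm_le_const (C := 1) (ae_of_all _ fun y => ?_)).trans (by simp)
  rw [norm_mul, Circle.norm_coe, one_mul]
  exact ha1 y

theorem continuous_expIntegral (hZ : Measurable Z) (ha : Measurable a) (ha1 : ∀ y, ‖a y‖ ≤ 1) :
    Continuous (expIntegral m Z a) := by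
  refine continuous_of_dominated (bound := fun _ => 1) (fun ξ => ?_) (fun ξ => ae_of_all _ fun y => ?_)
    (integrable_const _) (ae_of_all _ fun y => ?_)
  · exact Measurable.aestronglyMeasurable (by fun_prop)
  · rw [norm_mul, Circle.norm_coe, one_mul]
    exact ha1 y
  · fun_prop

theorem integral_cexp_mul_fourierChar {b : ℝ} (hb : 0 < b) (w : 𝔼) :
    ∫ ξ : 𝔼, Complex.exp (-b * ‖ξ‖ ^ 2) * ((Real.fourierChar (-inner ℝ w ξ) : Circle) : ℂ) =
      (((Real.pi / b) ^ (3 / 2 : ℝ) : ℝ) : ℂ) * Complex.exp (-Real.pi ^ 2 * ‖w‖ ^ 2 / b) := by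
  have h := fourier_gaussian_innerProductSpace (V := 𝔼) (b := (b : ℂ)) (by simpa using hb) w
  rw [Real.fourier_eq] at h
  have h3 : (((Real.pi / b) ^ (3 / 2 : ℝ) : ℝ) : ℂ) =
      (Real.pi / b : ℂ) ^ (Module.finrank ℝ 𝔼 / 2 : ℂ) := by
    rw [Complex.ofReal_cpow (by positivity)]; simp
  rw [h3, ← h]
  refine integral_congr_ae (ae_of_all _ fun ξ => ?_)
  simp only [Circle.smul_def, smul_eq_mul, real_inner_comm w ξ]
  ring

theorem cexp_eq_ofReal_rexp (b x : ℝ) : Complex.exp (-Real.pi ^ 2 * x ^ 2 / b) =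
    ((Real.exp (-(Real.pi ^ 2 / b) * x ^ 2) : ℝ) : ℂ) := by
  push_cast
  congr 1
  ring

/-- Expand the square as a double integral and integrate in `ξ` first; the Gaussian factor makes
Fubini legitimate and produces its own Fourier transform. -/
theorem integral_gaussian_mul_norm_sq_expIntegral (hZ : Measurable Z) (ha : Measurable a)
    (ha1 : ∀ y, ‖a y‖ ≤ 1) {b : ℝ} (hb : 0 < b) :
    ((∫ ξ, Real.exp (-b * ‖ξ‖ ^ 2) * ‖expIntegral m Z a ξ‖ ^ 2 : ℝ) : ℂ) =
      (((Real.pi / b) ^ (3 / 2 : ℝ) : ℝ) : ℂ) * ∫ p : Y × Y, a p.1 * starRingEnd ℂ (a p.2) *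
        Complex.exp (-Real.pi ^ 2 * ‖Z p.1 - Z p.2‖ ^ 2 / b) ∂(m.prod m) := by
  set Γ : 𝔼 → Y × Y → ℂ := fun ξ p => Complex.exp (-b * ‖ξ‖ ^ 2) *
    (((Real.fourierChar (-inner ℝ (Z p.1 - Z p.2) ξ) : Circle) : ℂ) * (a p.1 * starRingEnd ℂ (a p.2))) with hΓ
  have h1 (ξ : 𝔼) : ((Real.exp (-b * ‖ξ‖ ^ 2) * ‖expIntegral m Z a ξ‖ ^ 2 : ℝ) : ℂ) =
      ∫ p, Γ ξ p ∂(m.prod m) := by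
    simp only [hΓ]
    rw [integral_const_mul]
    push_cast
    congr 1
    rw [← Complex.mul_conj', expIntegral, ← integral_conj, ← integral_prod_mul]
    refine integral_congr_ae (ae_of_all _ fun p => ?_)
    have hsplit : -inner ℝ (Z p.1 - Z p.2) ξ = -inner ℝ (Z p.1) ξ + inner ℝ (Z p.2) ξ := by
      rw [inner_sub_left]; ring
    beta_reduce
    rw [hsplit, AddChar.map_add_eq_mul, Circle.coe_mul, map_mul, ← Circle.coe_inv_eq_conj,
      ← AddChar.map_neg_eq_inv, neg_neg]
    ring
  have hint : Integrable (Function.uncurry Γ) (volume.prod (m.prod m)) := by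
    have hg : Integrable (fun ξ : 𝔼 => Complex.exp (-b * ‖ξ‖ ^ 2)) := by
      simpa using GaussianFourier.integrable_cexp_neg_mul_sq_norm_add (V := 𝔼) (b := (b : ℂ))
        (by simpa using hb) 0 0
    refine (hg.mul_prod (integrable_const (1 : ℂ) (μ := m.prod m))).mono ?_ (ae_of_all _ ?_)
    · exact Measurable.aestronglyMeasurable (by simp only [hΓ, Function.uncurry_def]; fun_prop)
    · rintro ⟨ξ, p⟩
      simp only [Function.uncurry, hΓ, norm_mul, Circle.norm_coe, one_mul, RCLike.norm_conj,
        norm_one]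
      refine mul_le_mul_of_nonneg_left ?_ (norm_nonneg _)
      exact mul_le_one₀ (ha1 _) (norm_nonneg _) (ha1 _)
  calc _ = ∫ ξ, ((Real.exp (-b * ‖ξ‖ ^ 2) * ‖expIntegral m Z a ξ‖ ^ 2 : ℝ) : ℂ) :=
        integral_ofReal.symm
    _ = ∫ ξ, ∫ p, Γ ξ p ∂(m.prod m) := by simp only [h1]
    _ = ∫ p, ∫ ξ, Γ ξ p ∂volume ∂(m.prod m) := integral_integral_swap hint
    _ = _ := by
      rw [← integral_const_mul]
      refine integral_congr_ae (ae_of_all _ fun p => ?_)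
      simp only [hΓ, ← mul_assoc]
      rw [integral_mul_const, integral_mul_const, integral_cexp_mul_fourierChar hb]
      ring

/-- The Gaussian energy of the push-forward of `m` under `Z`. -/
noncomputable def gaussEnergy (m : Measure Y) (Z : Y → 𝔼) (b : ℝ) : ℝ≥0∞ :=
  ∫⁻ y, ∫⁻ y', ENNReal.ofReal (Real.exp (-(Real.pi ^ 2 / b) * ‖Z y - Z y'‖ ^ 2)) ∂m ∂m

theorem gaussEnergy_lt_top {b : ℝ} (hb : 0 < b) : gaussEnergy m Z b < ⊤ := by
  calc gaussEnergy m Z b ≤ ∫⁻ y, ∫⁻ y', 1 ∂m ∂m := by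
        refine lintegral_mono fun y => lintegral_mono fun y' => ?_
        rw [← ENNReal.ofReal_one]
        refine ENNReal.ofReal_le_ofReal (Real.exp_le_one_iff.2 ?_)
        have : 0 < Real.pi ^ 2 / b := by positivity
        nlinarith [mul_nonneg this.le (sq_nonneg ‖Z y - Z y'‖)]
    _ < ⊤ := by
        simp only [lintegral_one, lintegral_const]
        exact ENNReal.mul_lt_top (measure_lt_top _ _) (measure_lt_top _ _)

theorem integrable_exp_neg_sq_dist (hZ : Measurable Z) {b : ℝ} (hb : 0 < b) :
    Integrable (fun p : Y × Y => Real.exp (-(Real.pi ^ 2 / b) * ‖Z p.1 - Z p.2‖ ^ 2))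
      (m.prod m) := by
  refine (integrable_const (1 : ℝ)).mono (Measurable.aestronglyMeasurable (by fun_prop))
    (ae_of_all _ fun p => ?_)
  rw [Real.norm_of_nonneg (Real.exp_pos _).le, norm_one]
  refine (Real.exp_le_one_iff.2 ?_)
  have : 0 < Real.pi ^ 2 / b := by positivity
  nlinarith [mul_nonneg this.le (sq_nonneg ‖Z p.1 - Z p.2‖)]

theorem ofReal_integral_eq_gaussEnergy (hZ : Measurable Z) {b : ℝ} (hb : 0 < b) :
    ENNReal.ofReal (∫ p : Y × Y, Real.exp (-(Real.pi ^ 2 / b) * ‖Z p.1 - Z p.2‖ ^ 2) ∂(m.prod m)) =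
      gaussEnergy m Z b := by
  rw [ofReal_integral_eq_lintegral_ofReal, lintegral_prod _ (by fun_prop), gaussEnergy]
  · exact integrable_exp_neg_sq_dist hZ hb
  · exact ae_of_all _ fun p => (Real.exp_pos _).le

theorem lintegral_gaussian_eq_ofReal_integral (hZ : Measurable Z) (ha : Measurable a)
    (ha1 : ∀ y, ‖a y‖ ≤ 1) {b : ℝ} (hb : 0 < b) :
    ∫⁻ ξ, ENNReal.ofReal (Real.exp (-b * ‖ξ‖ ^ 2)) * ‖expIntegral m Z a ξ‖ₑ ^ 2 =
      ENNReal.ofReal (∫ ξ, Real.exp (-b * ‖ξ‖ ^ 2) * ‖expIntegral m Z a ξ‖ ^ 2) := by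
  have hc := continuous_expIntegral (m := m) hZ ha ha1
  have hg : Integrable (fun ξ : 𝔼 => Real.exp (-b * ‖ξ‖ ^ 2)) := by
    have h := (GaussianFourier.integrable_cexp_neg_mul_sq_norm_add (V := 𝔼) (b := (b : ℂ))
        (by simpa using hb) 0 0).norm
    refine h.congr (ae_of_all _ fun ξ => ?_)
    simp only [zero_mul, add_zero, Complex.norm_exp]
    congr 1
    norm_cast
  rw [ofReal_integral_eq_lintegral_ofReal]
  · refine lintegral_congr fun ξ => ?_
    rw [ENNReal.ofReal_mul (Real.exp_pos _).le, ENNReal.ofReal_pow (norm_nonneg _), ofReal_norm]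
  · refine hg.mul_bdd (c := (m.real Set.univ) ^ 2) (by fun_prop) (ae_of_all _ fun ξ => ?_)
    rw [norm_pow, norm_norm]
    gcongr
    exact norm_expIntegral_le ha1 ξ
  · exact ae_of_all _ fun p => by positivity

/-- The kernel on the spatial side is positive, so any amplitude of modulus at most 1 is dominated
by the amplitude 1. This is where the phase disappears. -/
theorem lintegral_gaussian_mul_expIntegral_le (hZ : Measurable Z) (ha : Measurable a)
    (ha1 : ∀ y, ‖a y‖ ≤ 1) {b : ℝ} (hb : 0 < b) :
    ∫⁻ ξ, ENNReal.ofReal (Real.exp (-b * ‖ξ‖ ^ 2)) * ‖expIntegral m Z a ξ‖ₑ ^ 2 ≤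
      ENNReal.ofReal ((Real.pi / b) ^ (3 / 2 : ℝ)) * gaussEnergy m Z b := by
  rw [lintegral_gaussian_eq_ofReal_integral hZ ha ha1 hb, ← ofReal_integral_eq_gaussEnergy hZ hb,
    ← ENNReal.ofReal_mul (by positivity)]
  refine ENNReal.ofReal_le_ofReal ?_
  have h := congrArg norm (integral_gaussian_mul_norm_sq_expIntegral (m := m) hZ ha ha1 hb)
  rw [Complex.norm_real, norm_mul, Complex.norm_real, Real.norm_of_nonneg (integral_nonneg
    fun ξ => by positivity), Real.norm_of_nonneg (by positivity)] at h
  rw [h]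
  refine mul_le_mul_of_nonneg_left ?_ (by positivity)
  refine norm_integral_le_of_norm_le (integrable_exp_neg_sq_dist hZ hb) (ae_of_all _ fun p => ?_)
  rw [cexp_eq_ofReal_rexp, norm_mul, norm_mul, RCLike.norm_conj, Complex.norm_real,
    Real.norm_of_nonneg (Real.exp_pos _).le]
  exact mul_le_of_le_one_left (Real.exp_pos _).le (mul_le_one₀ (ha1 _) (norm_nonneg _) (ha1 _))

theorem lintegral_gaussian_mul_expIntegral_one (hZ : Measurable Z) {b : ℝ} (hb : 0 < b) :
    ∫⁻ ξ, ENNReal.ofReal (Real.exp (-b * ‖ξ‖ ^ 2)) * ‖expIntegral m Z 1 ξ‖ₑ ^ 2 =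
      ENNReal.ofReal ((Real.pi / b) ^ (3 / 2 : ℝ)) * gaussEnergy m Z b := by
  rw [lintegral_gaussian_eq_ofReal_integral hZ measurable_one (by simp) hb,
    ← ofReal_integral_eq_gaussEnergy hZ hb, ← ENNReal.ofReal_mul (by positivity)]
  congr 1
  have h := integral_gaussian_mul_norm_sq_expIntegral (m := m) hZ measurable_one
    (by simp : ∀ y : Y, ‖(1 : Y → ℂ) y‖ ≤ 1) hb
  rw [← Complex.ofReal_inj, h]
  push_cast
  congr 1
  refine Eq.trans ?_ integral_ofReal
  refine integral_congr_ae (ae_of_all _ fun p => ?_)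
  simp only [cexp_eq_ofReal_rexp, Pi.one_apply, map_one, one_mul]
  rfl

end ExponentialIntegral

theorem lintegral_gaussian_mul_gaussian {c : ℝ} (hc : 0 < c) (u v : 𝔼) :
    ∫⁻ x : 𝔼, ENNReal.ofReal (Real.exp (-c * ‖x - u‖ ^ 2)) *
      ENNReal.ofReal (Real.exp (-c * ‖x - v‖ ^ 2)) =
    ENNReal.ofReal ((Real.pi / (2 * c)) ^ (3 / 2 : ℝ)) *
      ENNReal.ofReal (Real.exp (-(c / 2) * ‖u - v‖ ^ 2)) := by
  have hpt (x : 𝔼) : ENNReal.ofReal (Real.exp (-c * ‖x - u‖ ^ 2)) *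
      ENNReal.ofReal (Real.exp (-c * ‖x - v‖ ^ 2)) =
      ENNReal.ofReal (Real.exp (-(2 * c) * ‖x - (1 / 2 : ℝ) • (u + v)‖ ^ 2)) *
      ENNReal.ofReal (Real.exp (-(c / 2) * ‖u - v‖ ^ 2)) := by
    rw [← ENNReal.ofReal_mul (Real.exp_pos _).le, ← ENNReal.ofReal_mul (Real.exp_pos _).le,
      ← Real.exp_add, ← Real.exp_add]
    congr 2
    have h := parallelogram_law_with_norm ℝ (x - u) (x - v)
    rw [show x - u + (x - v) = (2 : ℝ) • (x - (1 / 2 : ℝ) • (u + v)) by module,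
      show x - u - (x - v) = -(u - v) by abel, norm_neg, norm_smul,
      Real.norm_of_nonneg two_pos.le] at h
    linear_combination (c / 2) * h
  simp_rw [hpt]
  rw [lintegral_mul_const _ (by fun_prop)]
  congr 1
  rw [lintegral_sub_right_eq_self (fun x : 𝔼 => ENNReal.ofReal (Real.exp (-(2 * c) * ‖x‖ ^ 2))),
    ← ofReal_integral_eq_lintegral_ofReal]
  · rw [GaussianFourier.integral_rexp_neg_mul_sq_norm (by positivity)]
    simp
  · by_contra h
    have := integral_undef h
    rw [GaussianFourier.integral_rexp_neg_mul_sq_norm (by positivity)] at this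
    exact (by positivity : (Real.pi / (2 * c)) ^ (Module.finrank ℝ 𝔼 / 2 : ℝ) ≠ 0) this
  · exact ae_of_all _ fun x => (Real.exp_pos _).le

section ExponentialIntegral

variable {Y : Type*} [MeasurableSpace Y] {m : Measure Y} [IsFiniteMeasure m] {Z : Y → 𝔼}

/-- The hypothesis is tested on the Gaussian smoothing `W` of the push-forward itself: `∫ W(Z) dm`
is the energy at `b`, and `∫ W²` is a multiple of the energy at `2b`. In normalised form `R(b)² ≤ B
R(2b) ≤ B R(b)`, and `R(b)` is finite, so it can be cancelled. -/
theorem ofReal_mul_gaussEnergy_le (hZ : Measurable Z) {B : ℝ≥0∞}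
    (hB : ∀ W : 𝔼 → ℝ≥0∞, LowerSemicontinuous W → (∃ K : ℝ≥0, ∀ x, W x ≤ K) →
      ∫⁻ x, W x ^ 2 ≠ ⊤ → (∫⁻ y, W (Z y) ∂m) ^ 2 ≤ B * ∫⁻ x, W x ^ 2) {b : ℝ} (hb : 0 < b) :
    ENNReal.ofReal ((Real.pi / b) ^ (3 / 2 : ℝ)) * gaussEnergy m Z b ≤ B := by
  set R : ℝ → ℝ≥0∞ := fun b => ENNReal.ofReal ((Real.pi / b) ^ (3 / 2 : ℝ)) * gaussEnergy m Z b
    with hR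
  -- Monotonicity is visible only on the frequency side, where `b` enters through `exp(-b‖ξ‖²)`.
  have hmono : R (2 * b) ≤ R b := by
    simp only [hR]
    rw [← lintegral_gaussian_mul_expIntegral_one hZ hb,
      ← lintegral_gaussian_mul_expIntegral_one hZ (by positivity)]
    gcongr
    linarith
  set c := Real.pi ^ 2 / b with hc
  have hc0 : 0 < c := by positivity
  set W : 𝔼 → ℝ≥0∞ := fun x => ∫⁻ y', ENNReal.ofReal (Real.exp (-c * ‖x - Z y'‖ ^ 2)) ∂m with hW
  have hWl : LowerSemicontinuous W := by
    refine LowerSemicontinuous.lintegral_param (fun y => Continuous.lowerSemicontinuous ?_)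
      (fun x => by fun_prop)
    exact ENNReal.continuous_ofReal.comp (by fun_prop)
  have hW2 : ∫⁻ x, W x ^ 2 = ENNReal.ofReal ((Real.pi / (2 * c)) ^ (3 / 2 : ℝ)) *
      gaussEnergy m Z (2 * b) := by
    calc _ = ∫⁻ x, ∫⁻ p : Y × Y, ENNReal.ofReal (Real.exp (-c * ‖x - Z p.1‖ ^ 2)) *
          ENNReal.ofReal (Real.exp (-c * ‖x - Z p.2‖ ^ 2)) ∂(m.prod m) := by
          refine lintegral_congr fun x => ?_
          rw [sq, lintegral_prod_mul (f := fun y => ENNReal.ofReal (Real.exp (-c * ‖x - Z y‖ ^ 2)))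
            (g := fun y => ENNReal.ofReal (Real.exp (-c * ‖x - Z y‖ ^ 2)))
            (by fun_prop) (by fun_prop)]
      _ = ∫⁻ p : Y × Y, ENNReal.ofReal ((Real.pi / (2 * c)) ^ (3 / 2 : ℝ)) *
          ENNReal.ofReal (Real.exp (-(c / 2) * ‖Z p.1 - Z p.2‖ ^ 2)) ∂(m.prod m) := by
          rw [lintegral_lintegral_swap (by fun_prop)]
          exact lintegral_congr fun p => lintegral_gaussian_mul_gaussian hc0 _ _
      _ = _ := by
          rw [lintegral_const_mul _ (by fun_prop), lintegral_prod _ (by fun_prop), gaussEnergy]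
          rw [show Real.pi ^ 2 / (2 * b) = c / 2 by rw [hc]; field_simp]
  have hfin (b : ℝ) (hb : 0 < b) : R b ≠ ⊤ :=
    ENNReal.mul_ne_top ENNReal.ofReal_ne_top (gaussEnergy_lt_top hb).ne
  have hsq : R b ^ 2 ≤ B * R (2 * b) := by
    have h := hB W hWl ⟨(m Set.univ).toNNReal, fun x => ?_⟩ ?_
    · calc R b ^ 2 = ENNReal.ofReal ((Real.pi / b) ^ (3 / 2 : ℝ)) ^ 2 *
            (∫⁻ y, W (Z y) ∂m) ^ 2 := by simp only [hR, mul_pow, hW]; rfl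
        _ ≤ ENNReal.ofReal ((Real.pi / b) ^ (3 / 2 : ℝ)) ^ 2 * (B * ∫⁻ x, W x ^ 2) :=
            mul_le_mul_right h _
        _ = B * ((ENNReal.ofReal ((Real.pi / b) ^ (3 / 2 : ℝ)) ^ 2 *
            ENNReal.ofReal ((Real.pi / (2 * c)) ^ (3 / 2 : ℝ))) * gaussEnergy m Z (2 * b)) := by
            rw [hW2]; ring
        _ = _ := by
            simp only [hR]
            -- With `c = π²/b` the constants satisfy `(π/b)² · π/(2c) = π/(2b)`.
            congr 2
            rw [← ENNReal.ofReal_pow (by positivity), ← ENNReal.ofReal_mul (by positivity), sq,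
              ← Real.mul_rpow (by positivity) (by positivity),
              ← Real.mul_rpow (by positivity) (by positivity)]
            congr 2
            rw [hc]
            field_simp
    · rw [ENNReal.coe_toNNReal (measure_ne_top _ _)]
      calc W x ≤ ∫⁻ y', 1 ∂m := by
            refine lintegral_mono fun y' => ?_
            rw [← ENNReal.ofReal_one]
            refine ENNReal.ofReal_le_ofReal (Real.exp_le_one_iff.2 ?_)
            nlinarith [mul_nonneg hc0.le (sq_nonneg ‖x - Z y'‖)]
        _ = _ := by simp
    · rw [hW2]
      exact ENNReal.mul_ne_top ENNReal.ofReal_ne_top (gaussEnergy_lt_top (by positivity)).ne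
  change R b ≤ B
  rcases eq_or_ne (R b) 0 with h0 | h0
  · rw [h0]; exact zero_le
  · rw [← ENNReal.mul_le_mul_iff_left h0 (hfin b hb), ← sq]
    exact hsq.trans (mul_le_mul_right hmono _)

/-- The Gaussian bounds are uniform in `b`; let `b → 0` by Fatou. -/
theorem lintegral_norm_expIntegral_sq_le (hZ : Measurable Z) {B : ℝ≥0∞}
    (hB : ∀ W : 𝔼 → ℝ≥0∞, LowerSemicontinuous W → (∃ K : ℝ≥0, ∀ x, W x ≤ K) →
      ∫⁻ x, W x ^ 2 ≠ ⊤ → (∫⁻ y, W (Z y) ∂m) ^ 2 ≤ B * ∫⁻ x, W x ^ 2)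
    {a : Y → ℂ} (ha : Measurable a) (ha1 : ∀ y, ‖a y‖ ≤ 1) :
    ∫⁻ ξ, ‖expIntegral m Z a ξ‖ₑ ^ 2 ≤ B := by
  set b : ℕ → ℝ := fun n => 1 / (n + 1) with hb
  have hb0 (n) : 0 < b n := by positivity
  have hbt : Filter.Tendsto b .atTop (nhds 0) := tendsto_one_div_add_atTop_nhds_zero_nat
  have hc := continuous_expIntegral (m := m) hZ ha ha1
  calc _ = ∫⁻ ξ, Filter.liminf (fun n => ENNReal.ofReal (Real.exp (-b n * ‖ξ‖ ^ 2)) *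
        ‖expIntegral m Z a ξ‖ₑ ^ 2) .atTop := by
        refine lintegral_congr fun ξ => (Filter.Tendsto.liminf_eq ?_).symm
        have h1 : Filter.Tendsto (fun n => ENNReal.ofReal (Real.exp (-b n * ‖ξ‖ ^ 2))) .atTop
            (nhds 1) := by
          have : Filter.Tendsto (fun n => Real.exp (-b n * ‖ξ‖ ^ 2)) .atTop
              (nhds (Real.exp (-0 * ‖ξ‖ ^ 2))) :=
            (Real.continuous_exp.tendsto _).comp (hbt.neg.mul_const _)
          simpa using ENNReal.tendsto_ofReal this
        simpa using ENNReal.Tendsto.mul_const h1 (Or.inl one_ne_zero)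
          (b := ‖expIntegral m Z a ξ‖ₑ ^ 2)
    _ ≤ Filter.liminf (fun n => ∫⁻ ξ, ENNReal.ofReal (Real.exp (-b n * ‖ξ‖ ^ 2)) *
        ‖expIntegral m Z a ξ‖ₑ ^ 2) .atTop := lintegral_liminf_le fun n => by fun_prop
    _ ≤ B := by
        refine Filter.liminf_le_of_le (by isBoundedDefault) fun x hx => ?_
        obtain ⟨n, hn⟩ := hx.exists
        exact hn.trans ((lintegral_gaussian_mul_expIntegral_le hZ ha ha1 (hb0 n)).trans
          (ofReal_mul_gaussEnergy_le hZ hB (hb0 n)))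

end ExponentialIntegral

/-! ### The `L⁴` bound and duality -/

/-- The square of a Fourier transform is the transform of the self-convolution, here the
push-forward of `κ × κ` under addition, so the `L²` bound applies to it. -/
theorem lintegral_norm_expIntegral_pow_four_le {κ : Measure 𝔼} [IsFiniteMeasure κ] {B : ℝ≥0∞}
    (hB : ∀ W : 𝔼 → ℝ≥0∞, LowerSemicontinuous W → (∃ K : ℝ≥0, ∀ x, W x ≤ K) →
      ∫⁻ x, W x ^ 2 ≠ ⊤ → (∫⁻ z, ∫⁻ z', W (z + z') ∂κ ∂κ) ^ 2 ≤ B * ∫⁻ x, W x ^ 2)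
    {s : 𝔼 → ℂ} (hs : Measurable s) (hs1 : ∀ z, ‖s z‖ ≤ 1) :
    ∫⁻ ξ, ‖expIntegral κ id s ξ‖ₑ ^ 4 ≤ B := by
  have hsq (ξ : 𝔼) : expIntegral (κ.prod κ) (fun p : 𝔼 × 𝔼 => p.1 + p.2)
      (fun p => s p.1 * s p.2) ξ = expIntegral κ id s ξ ^ 2 := by
    rw [sq, expIntegral, expIntegral, ← integral_prod_mul]
    refine integral_congr_ae (ae_of_all _ fun p => ?_)
    beta_reduce
    rw [inner_add_left, neg_add, AddChar.map_add_eq_mul, Circle.coe_mul]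
    simp only [id]
    ring
  have h := lintegral_norm_expIntegral_sq_le (m := κ.prod κ) (Z := fun p : 𝔼 × 𝔼 => p.1 + p.2)
    (by fun_prop) (B := B) (fun W hW hK hW2 => ?_) (a := fun p => s p.1 * s p.2) (by fun_prop)
    (fun p => by rw [norm_mul]; exact mul_le_one₀ (hs1 _) (norm_nonneg _) (hs1 _))
  · simpa only [hsq, enorm_pow, ← pow_mul] using h
  · have hWm := hW.measurable
    rw [lintegral_prod _ (by fun_prop)]
    exact hB W hW hK hW2

theorem eLpNorm_le_of_pow_four_le {X F : Type*} [MeasurableSpace X] [NormedAddCommGroup F]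
    {ν : Measure X} {v : X → F} {D : ℝ≥0∞} (hv : ∀ x, ‖v x‖ₑ ≤ D) (h4 : ∫⁻ x, ‖v x‖ₑ ^ 4 ∂ν ≤ D ^ 4)
    (hvm : AEStronglyMeasurable v ν) {q : ℝ≥0∞} (hq : 4 ≤ q) : eLpNorm v q ν ≤ D := by
  rcases eq_or_ne q ⊤ with rfl | hqt
  · rw [eLpNorm_exponent_top]
    exact essSup_le_of_ae_le _ (ae_of_all _ hv)
  have hq4 : 4 ≤ q.toReal := by
    have := ENNReal.toReal_mono hqt hq
    simpa using this
  have hq0 : 0 < q.toReal := by linarith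
  have hsplit (x : ℝ≥0∞) : x ^ q.toReal = x ^ (q.toReal - 4) * x ^ 4 := by
    rw [← ENNReal.rpow_natCast x 4, ← ENNReal.rpow_add_of_nonneg _ _ (by linarith) (by norm_num)]
    norm_num
  rw [eLpNorm_eq_lintegral_rpow_enorm_toReal (by rintro rfl; simp at hq) hqt, one_div,
    ENNReal.rpow_inv_le_iff hq0, hsplit]
  calc _ ≤ ∫⁻ x, D ^ (q.toReal - 4) * ‖v x‖ₑ ^ 4 ∂ν := by
        refine lintegral_mono fun x => ?_
        rw [hsplit]
        exact mul_le_mul_left (ENNReal.rpow_le_rpow (hv x) (by linarith)) _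
    _ = D ^ (q.toReal - 4) * ∫⁻ x, ‖v x‖ₑ ^ 4 ∂ν := lintegral_const_mul'' _ (by fun_prop)
    _ ≤ _ := mul_le_mul_right h4 _

/-- Duality: an estimate on sums `z + z'` for a finite measure `κ` gives a restriction estimate for the
Fourier transform with respect to `κ`. -/
theorem lintegral_norm_fourier_le {κ : Measure 𝔼} [IsFiniteMeasure κ] {D : ℝ≥0∞}
    (hD : κ Set.univ ≤ D)
    (hB : ∀ W : 𝔼 → ℝ≥0∞, LowerSemicontinuous W → (∃ K : ℝ≥0, ∀ x, W x ≤ K) →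
      ∫⁻ x, W x ^ 2 ≠ ⊤ → (∫⁻ z, ∫⁻ z', W (z + z') ∂κ ∂κ) ^ 2 ≤ D ^ 4 * ∫⁻ x, W x ^ 2)
    {p : ℝ≥0∞} (hp1 : 1 ≤ p) (hp2 : p ≤ 4 / 3) {f : 𝔼 → ℂ} (hf : Integrable f) :
    ∫⁻ z, ‖𝓕 f z‖ₑ ∂κ ≤ D * eLpNorm f p := by
  have hfc : Continuous (𝓕 f) :=
    VectorFourier.fourierIntegral_continuous Real.continuous_fourierChar continuous_inner hf
  -- The conjugate phase of `𝓕 f`, equal to 0 at its zeros because `0⁻¹ = 0`.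
  set s : 𝔼 → ℂ := fun z => ((‖𝓕 f z‖⁻¹ : ℝ) : ℂ) * starRingEnd ℂ (𝓕 f z) with hs
  have hsm : Measurable s := by
    have := hfc.measurable
    simp only [hs]
    fun_prop
  have hs1 (z : 𝔼) : ‖s z‖ ≤ 1 := by
    simp only [hs, norm_mul, RCLike.norm_conj, Complex.norm_real, norm_inv, norm_norm]
    exact inv_mul_le_one
  have hprod (z : 𝔼) : 𝓕 f z * s z = (‖𝓕 f z‖ : ℂ) := by
    simp only [hs]
    rw [mul_left_comm, Complex.mul_conj']
    rcases eq_or_ne ‖𝓕 f z‖ 0 with h | h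
    · simp [h]
    · have : (‖𝓕 f z‖ : ℂ) ≠ 0 := by exact_mod_cast h
      push_cast
      field_simp
  have hsi : Integrable s κ :=
    (integrable_const (1 : ℝ)).mono' hsm.aestronglyMeasurable (ae_of_all _ hs1)
  -- The multiplication formula moves the Fourier transform from `f` to `s κ`.
  have hflip : ∫ z, ((‖𝓕 f z‖ : ℝ) : ℂ) ∂κ = ∫ x, f x * expIntegral κ id s x := by
    have h := VectorFourier.integral_fourierIntegral_smul_eq_flip (μ := (volume : Measure 𝔼))
      (ν := κ) (L := innerₗ 𝔼) Real.continuous_fourierChar continuous_inner hf hsi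
    simp only [smul_eq_mul] at h
    calc _ = ∫ z, 𝓕 f z * s z ∂κ := by simp only [hprod]
      _ = _ := h
      _ = _ := by
        refine integral_congr_ae (ae_of_all _ fun x => ?_)
        simp only [VectorFourier.fourierIntegral, expIntegral, id, LinearMap.flip_apply,
          innerₗ_apply_apply, Circle.smul_def, smul_eq_mul, real_inner_comm x]
  have hvc := continuous_expIntegral (m := κ) measurable_id hsm hs1
  have hvb (ξ : 𝔼) : ‖expIntegral κ id s ξ‖ₑ ≤ D := by
    refine le_trans ?_ hD
    rw [← ofReal_norm, ← ofReal_measureReal]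
    exact ENNReal.ofReal_le_ofReal (norm_expIntegral_le hs1 ξ)
  have h4 := lintegral_norm_expIntegral_pow_four_le hB hsm hs1
  have : ENNReal.HolderConjugate (ENNReal.conjExponent p) p :=
    (ENNReal.HolderConjugate.conjExponent hp1).symm
  have hq : 4 ≤ ENNReal.conjExponent p := by
    have h43 : p - 1 ≤ 3⁻¹ := by
      rw [tsub_le_iff_right]
      refine hp2.trans (le_of_eq ?_)
      rw [ENNReal.div_eq_inv_mul, show (4 : ℝ≥0∞) = 1 + 3 by norm_num, mul_add,
        ENNReal.inv_mul_cancel (by norm_num) (by norm_num), mul_one]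
    calc (4 : ℝ≥0∞) = 1 + 3 := by norm_num
      _ ≤ _ := by
        rw [ENNReal.conjExponent]
        gcongr
        exact ENNReal.le_inv_iff_le_inv.2 h43
  have hbd : Integrable (fun z => ‖𝓕 f z‖) κ := by
    refine (integrable_const (∫ x, ‖f x‖)).mono' hfc.norm.aestronglyMeasurable
      (ae_of_all _ fun z => ?_)
    rw [norm_norm]
    exact VectorFourier.norm_fourierIntegral_le_integral_norm _ _ _ _ _
  have hreal : ∫⁻ z, ‖𝓕 f z‖ₑ ∂κ = ‖∫ z, ((‖𝓕 f z‖ : ℝ) : ℂ) ∂κ‖ₑ := by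
    have h : ∫ z, ((‖𝓕 f z‖ : ℝ) : ℂ) ∂κ = ((∫ z, ‖𝓕 f z‖ ∂κ : ℝ) : ℂ) := integral_ofReal
    rw [h, ← ofReal_norm, Complex.norm_real, Real.norm_of_nonneg
      (integral_nonneg fun z => norm_nonneg _), ofReal_integral_eq_lintegral_ofReal hbd
      (ae_of_all _ fun z => norm_nonneg _)]
    exact lintegral_congr fun z => (ofReal_norm _).symm
  have hle : ‖∫ x, f x * expIntegral κ id s x‖ₑ ≤ eLpNorm (expIntegral κ id s • f) 1 volume := by
    rw [eLpNorm_one_eq_lintegral_enorm]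
    refine (enorm_integral_le_lintegral_enorm _).trans (le_of_eq ?_)
    exact lintegral_congr fun x => by rw [mul_comm]; rfl
  have hholder : eLpNorm (expIntegral κ id s • f) 1 volume ≤
      eLpNorm (expIntegral κ id s) (ENNReal.conjExponent p) volume * eLpNorm f p :=
    eLpNorm_smul_le_mul_eLpNorm hf.aestronglyMeasurable hvc.aestronglyMeasurable
  rw [hreal, hflip]
  refine hle.trans (hholder.trans (mul_le_mul_left ?_ _))
  exact eLpNorm_le_of_pow_four_le hvb h4 hvc.aestronglyMeasurable hq

/-! ### Selecting radii and conclusion -/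

/-- Measurable selection of near-maximisers: along a sequence `u`, the running maximum of `I (u n) x`
is attained at a measurable choice of parameter. -/
theorem exists_measurable_running_argmax {X : Type*} [MeasurableSpace X] {I : ℝ → X → ℝ≥0∞}
    (hI : Measurable (Function.uncurry I)) (u : ℕ → ℝ) :
    ∃ τ : ℕ → X → ℝ, (∀ n, Measurable (τ n)) ∧ (∀ n x, ∃ k, τ n x = u k) ∧
      (∀ n x, I (τ n x) x ≤ I (τ (n + 1) x) x) ∧ ∀ n x, I (u n) x ≤ I (τ n x) x := by
  classical
  let τ : ℕ → X → ℝ := fun n => Nat.rec (fun _ => u 0)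
    (fun n σ x => if I (σ x) x ≤ I (u (n + 1)) x then u (n + 1) else σ x) n
  have hsucc (n : ℕ) (x : X) : τ (n + 1) x =
      if I (τ n x) x ≤ I (u (n + 1)) x then u (n + 1) else τ n x := rfl
  refine ⟨τ, fun n => ?_, fun n x => ?_, fun n x => ?_, fun n x => ?_⟩
  · induction n with
    | zero => exact measurable_const
    | succ n ih =>
      refine Measurable.ite (measurableSet_le ?_ ?_) measurable_const ih
      · exact hI.comp (ih.prodMk measurable_id)
      · exact hI.comp (measurable_const.prodMk measurable_id)
  · induction n with
    | zero => exact ⟨0, rfl⟩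
    | succ n ih =>
      rw [hsucc]
      split_ifs
      · exact ⟨_, rfl⟩
      · exact ih
  · rw [hsucc]
    split_ifs with h
    · exact h
    · exact le_rfl
  · cases n with
    | zero => exact le_rfl
    | succ n =>
      rw [hsucc]
      split_ifs with h
      · exact le_rfl
      · exact (not_le.1 h).le

/-- The averages themselves serve as the weight `g`. With `N = ∫ g²`, duality reads `N ≤ K N^{1/2}
‖f‖_p`, and `N` cancels because it is finite. -/
theorem exists_lintegral_fourier_average_sq_le {μ : Measure 𝔼} [IsFiniteMeasure μ]
    (hμ : MaximalBoundedL2 μ) {p : ℝ≥0∞} (hp1 : 1 ≤ p) (hp2 : p ≤ 4 / 3) :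
    ∃ K : ℝ≥0, ∀ f : 𝔼 → ℂ, Integrable f → ∀ τ : 𝕊 → ℝ, Measurable τ → (∀ ω, 0 < τ ω) →
      ∫⁻ ω, (∫⁻ y, ‖𝓕 f ((ω : 𝔼) - τ ω • y)‖ₑ ∂μ) ^ 2 ∂sphereMeasure ≤
        (K * eLpNorm f p) ^ 2 := by
  obtain ⟨C, hC⟩ := exists_spreadMeasure_bilinear_sq_le hμ
  obtain ⟨S, hS⟩ : ∃ S : ℝ≥0, (S : ℝ≥0∞) = sphereMeasure Set.univ :=
    ⟨_, ENNReal.coe_toNNReal (measure_ne_top _ _)⟩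
  obtain ⟨U, hU⟩ : ∃ U : ℝ≥0, (U : ℝ≥0∞) = μ Set.univ :=
    ⟨_, ENNReal.coe_toNNReal (measure_ne_top _ _)⟩
  -- One `K` must serve both the mass bound (`L^∞`) and the bilinear bound (`L⁴`); the summand 1
  -- ensures that powers of `K` dominate `K`.
  obtain ⟨K, hK1, hK2⟩ : ∃ K : ℝ≥0, S * U ^ 2 ≤ K ^ 2 ∧ C ≤ K ^ 4 := by
    refine ⟨1 + C + S + U + S * U ^ 2, ?_, ?_⟩
    · calc _ ≤ (1 + C + S + U + S * U ^ 2) := le_add_self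
        _ ≤ _ := le_self_pow₀ (by simp only [add_assoc]; exact le_self_add) (by norm_num)
    · calc C ≤ 1 + C + S + U + S * U ^ 2 := by
            rw [show 1 + C + S + U + S * U ^ 2 = C + (1 + S + U + S * U ^ 2) by ring]
            exact le_self_add
        _ ≤ _ := le_self_pow₀ (by simp only [add_assoc]; exact le_self_add) (by norm_num)
  refine ⟨K, fun f hf τ hτ hτ0 => ?_⟩
  have hfc : Continuous (𝓕 f) :=
    VectorFourier.fourierIntegral_continuous Real.continuous_fourierChar continuous_inner hf
  have hfm := hfc.measurable
  set g : 𝕊 → ℝ≥0∞ := fun ω => ∫⁻ y, ‖𝓕 f ((ω : 𝔼) - τ ω • y)‖ₑ ∂μ with hg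
  have hgm : Measurable g := Measurable.lintegral_prod_right' (f := fun q : 𝕊 × 𝔼 =>
    ‖𝓕 f ((q.1 : 𝔼) - τ q.1 • q.2)‖ₑ) (by fun_prop)
  set N := ∫⁻ ω, g ω ^ 2 ∂sphereMeasure with hN
  -- This uses the integrability of `f`: `𝓕 f` is bounded by `‖f‖₁`, and `μ` and the surface measure
  -- are finite.
  have hNt : N ≠ ⊤ := by
    set L : ℝ≥0∞ := ENNReal.ofReal (∫ x, ‖f x‖) with hL
    have hgb (ω : 𝕊) : g ω ≤ L * U := by
      calc g ω ≤ ∫⁻ y, L ∂μ := by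
            refine lintegral_mono fun y => ?_
            rw [← ofReal_norm]
            exact ENNReal.ofReal_le_ofReal
              (VectorFourier.norm_fourierIntegral_le_integral_norm _ _ _ _ _)
        _ = _ := by rw [lintegral_const, hU]
    refine ne_top_of_le_ne_top ?_ (lintegral_mono fun ω => pow_le_pow_left' (hgb ω) 2)
    rw [lintegral_const, ← hS]
    exact ENNReal.mul_ne_top (ENNReal.pow_ne_top (ENNReal.mul_ne_top ENNReal.ofReal_ne_top
      ENNReal.coe_ne_top)) ENNReal.coe_ne_top
  set κ := spreadMeasure μ g τ with hκ
  set D : ℝ≥0∞ := K * N ^ (1 / 2 : ℝ) with hD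
  have hD2 : D ^ 2 = K ^ 2 * N := by
    rw [hD, mul_pow, ← ENNReal.rpow_natCast (N ^ _), ← ENNReal.rpow_mul]
    norm_num
  have hκD : κ Set.univ ≤ D := by
    have h1 : κ Set.univ = (∫⁻ ω, g ω * 1 ∂sphereMeasure) * U := by
      rw [← lintegral_one, hκ, lintegral_spreadMeasure hgm hτ measurable_const, lintegral_one, ← hU,
        lintegral_mul_const _ hgm]
      simp
    rw [← ENNReal.pow_le_pow_left_iff two_ne_zero, hD2, h1, mul_pow]
    calc _ ≤ (N * ∫⁻ ω : 𝕊, 1 ^ 2 ∂sphereMeasure) * U ^ 2 :=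
          mul_le_mul_left (ENNReal.lintegral_mul_sq_le hgm.aemeasurable aemeasurable_const) _
      _ = ((S * U ^ 2 : ℝ≥0) : ℝ≥0∞) * N := by
          rw [one_pow, lintegral_one, ← hS]; push_cast; ring
      _ ≤ ((K ^ 2 : ℝ≥0) : ℝ≥0∞) * N := by gcongr
      _ = _ := by push_cast; rfl
  have : IsFiniteMeasure κ := ⟨hκD.trans_lt (ENNReal.mul_lt_top ENNReal.coe_lt_top
    (ENNReal.rpow_lt_top_of_nonneg (by norm_num) hNt))⟩
  have hmain := lintegral_norm_fourier_le hκD (fun W hW hWb hW2 => ?_) hp1 hp2 hf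
  · rw [hκ, lintegral_spreadMeasure hgm hτ (by fun_prop)] at hmain
    have hmain' : N ≤ D * eLpNorm f p := by
      refine le_trans (le_of_eq ?_) hmain
      exact lintegral_congr fun ω => sq _
    have hsq := pow_le_pow_left' hmain' 2
    rw [mul_pow, hD2] at hsq
    rcases eq_or_ne N 0 with h0 | h0
    · rw [h0]; exact zero_le
    · rw [← ENNReal.mul_le_mul_iff_left h0 hNt, ← sq]
      exact hsq.trans (le_of_eq (by ring))
  · refine (hC g hgm τ hτ hτ0 W hW hWb hW2).trans (mul_le_mul_left ?_ _)
    calc (C : ℝ≥0∞) * N ^ 2 ≤ ((K ^ 4 : ℝ≥0) : ℝ≥0∞) * N ^ 2 := by gcongr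
      _ = (D ^ 2) ^ 2 := by rw [hD2]; push_cast; ring
      _ = D ^ 4 := by ring

theorem theorem3 (μ : Measure (EuclideanSpace ℝ (Fin 3))) [IsFiniteMeasure μ]
    (hμ : MaximalBoundedL2 μ) (p : ℝ≥0∞) (hp1 : 1 ≤ p) (hp2 : p ≤ 4 / 3) :
    ∃ C : ℝ≥0, ∀ f : EuclideanSpace ℝ (Fin 3) → ℂ, Integrable f volume → MemLp f p volume →
      eLpNorm (fun ω : Metric.sphere (0 : EuclideanSpace ℝ (Fin 3)) 1 =>
          maximalFn μ (𝓕 f) (ω : EuclideanSpace ℝ (Fin 3))) 2 sphereMeasure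
        ≤ C * eLpNorm f p volume := by
  obtain ⟨K, hK⟩ := exists_lintegral_fourier_average_sq_le hμ hp1 hp2
  refine ⟨K, fun f hf _ => ?_⟩
  have hfc : Continuous (𝓕 f) :=
    VectorFourier.fourierIntegral_continuous Real.continuous_fourierChar continuous_inner hf
  have hfm := hfc.measurable
  set I : ℝ → 𝕊 → ℝ≥0∞ := fun t ω => ∫⁻ y, ‖𝓕 f ((ω : 𝔼) - t • y)‖ₑ ∂μ with hI
  have hIm : Measurable (Function.uncurry I) :=
    Measurable.lintegral_prod_right' (f := fun q : (ℝ × 𝕊) × 𝔼 =>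
      ‖𝓕 f ((q.1.2 : 𝔼) - q.1.1 • q.2)‖ₑ) (by fun_prop)
  -- Lower semicontinuity in `t` makes every set `{t | c < I t ω}` open, so a countable dense set of
  -- radii computes the supremum.
  have hIl (ω : 𝕊) : LowerSemicontinuous fun t => I t ω :=
    LowerSemicontinuous.lintegral_param
      (fun y => Continuous.lowerSemicontinuous (by fun_prop)) (fun t => by fun_prop)
  set u : ℕ → Set.Ioi (0 : ℝ) := TopologicalSpace.denseSeq _ with hu
  obtain ⟨τ, hτm, hτu, hτmono, hτle⟩ := exists_measurable_running_argmax hIm fun n => (u n : ℝ)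
  have hτ0 (n : ℕ) (ω : 𝕊) : 0 < τ n ω := by
    obtain ⟨k, hk⟩ := hτu n ω
    rw [hk]; exact (u k).2
  have hsup (ω : 𝕊) : maximalFn μ (𝓕 f) ω ≤ ⨆ n, I (τ n ω) ω := by
    refine iSup₂_le fun t ht => ?_
    rw [lintegral_dilate μ hfm]
    refine le_of_forall_lt fun c hc => ?_
    have hopen : IsOpen {s : Set.Ioi (0 : ℝ) | c < I s ω} :=
      ((hIl ω).isOpen_preimage c).preimage continuous_subtype_val
    obtain ⟨n, hn⟩ := (TopologicalSpace.denseRange_denseSeq _).exists_mem_open hopen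
      ⟨⟨t, ht⟩, hc⟩
    exact hn.trans_le ((hτle n ω).trans (le_iSup (fun n => I (τ n ω) ω) n))
  rw [← ENNReal.pow_le_pow_left_iff two_ne_zero, eLpNorm_two_sq]
  -- The selected averages increase with `n`, so monotone convergence applies, and the bound for
  -- each `τ n` has the same constant.
  calc _ ≤ ∫⁻ ω, ⨆ n, I (τ n ω) ω ^ 2 ∂sphereMeasure := by
        refine lintegral_mono fun ω => ?_
        rw [enorm_eq_self]
        refine (pow_le_pow_left' (hsup ω) 2).trans (le_of_eq ?_)
        exact Monotone.map_iSup_of_continuousAt (f := fun x : ℝ≥0∞ => x ^ 2)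
          (ENNReal.continuous_pow 2).continuousAt (fun _ _ h => pow_le_pow_left' h 2) (by simp)
    _ = ⨆ n, ∫⁻ ω, I (τ n ω) ω ^ 2 ∂sphereMeasure := by
        refine lintegral_iSup (fun n => ?_) ?_
        · exact (hIm.comp ((hτm n).prodMk measurable_id)).pow_const 2
        · exact monotone_nat_of_le_succ fun n ω => pow_le_pow_left' (hτmono n ω) 2
    _ ≤ _ := iSup_le fun n => hK f hf (τ n) (hτm n) (hτ0 n)
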